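/- Work over $\mathbb{Q}$. Let $NSym=\mathbb{Q}\langle H_1,H_2,\dots\rangle$ be the algebra of noncommutative symmetric functions, with $H_0=1$ and $H_m=0$ for $m<0$, and $H_\alpha=H_{\alpha_1}\cdots H_{\alpha_k}$ for a composition $\alpha=(\alpha_1,\dots,\alpha_k)$, whose length is $\ell(\alpha)=k$. Write $\alpha\preceq\beta$ if $\alpha$ and $\beta$ are compositions of the same integer and $\alpha$ refines $\beta$. The ribbon functions are $R_\alpha=\sum_{\beta\succeq\alpha}(-1)^{\ell(\alpha)-\ell(\beta)}H_\beta$. Pair $NSym$ with the algebra $QSym$ of quasisymmetric functions by $\langle H_\alpha,M_\beta\rangle=\delta_{\alpha,\beta}$, where $M_\beta=\sum_{i_1<\cdots<i_k}x_{i_1}^{\beta_1}\cdots x_{i_k}^{\beta_k}$, and put $F_\alpha=\sum_{\beta\preceq\alpha}M_\beta$. For $F\in QSym$ let $F^\perp$ be the linear operator on $NSym$ given by $\langle F^\perp h,G\rangle=\langle h,FG\rangle$ for all $G\in QSym$, that is, $F^\perp h=\sum_\gamma\langle h,FM_\gamma\rangle H_\gamma$. For $m\in\mathbb{Z}$ let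 $\mathbb{B}_m=\sum_{i\ge 0}(-1)^iH_{m+i}F_{1^i}^\perp$, where $1^i=(1,\dots,1)$ has $i$ parts. The immaculate function of a composition $\beta=(\beta_1,\dots,\beta_k)$ is $\mathfrak{S}_\beta=\mathbb{B}_{\beta_1}\cdots\mathbb{B}_{\beta_k}(1)$. A standard immaculate tableau of shape $\alpha\models n$ is a filling of the left-justified diagram with $\alpha_i$ boxes in row $i$ (row $1$ on top) by $1,\dots,n$, each used exactly once, that increases from left to right along every row and strictly increases from top to bottom in the first column. Its descents are the $d\in\{1,\dots,n-1\}$ such that $d+1$ lies in a strictly lower row than $d$; if these are $d_1<\cdots<d_r$, its descent composition is $(d_1,d_2-d_1,\dots,n-d_r)$. Let $L_{\alpha,\beta}$ be the number of standard immaculate tableaux of shape $\alpha$ with descent composition $\beta$. The immaculate descent graph $\mathfrak{D}^n$ is the simple directed graph whose vertices are the compositions of $n$, with an edge from $\alpha$ to $\beta\neq\alpha$, of weight $L_{\alpha,\beta}$, whenever there is a standard immaculate tableau of shape $\alpha$ with descent composition $\beta$. Corollary. For every composition $\beta\models n$, $$\mathfrak{S}_\beta=\sum_{\alpha\models n}L^{-1}_{\alpha,\beta}\,R_\alpha\qquad\text{with}\qquad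 L^{-1}_{\alpha,\beta}=\sum_{\mathcal P}(-1)^{\ell(\mathcal P)}\,\mathrm{prod}(\mathcal P),$$ where $\mathcal P$ runs over the directed paths from $\alpha$ to $\beta$ in $\mathfrak{D}^n$ (for $\alpha=\beta$ this includes the empty path), $\ell(\mathcal P)$ is the number of edges of $\mathcal P$, and $\mathrm{prod}(\mathcal P)$ is the product of its edge weights, equal to $1$ for the empty path. -/

import Mathlib

/-!
The algebra `NSym` of noncommutative symmetric functions, its pairing with quasisymmetric
functions, the noncommutative Bernstein operators, the immaculate and the ribbon functions,
standard immaculate tableaux and the immaculate descent graph.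

Compositions of `n` are Mathlib's `Composition n`.
-/

noncomputable section

namespace Immaculate

open scoped Classical

/-! ### Compositions -/

/-- The refinement order: `Refines α β` says that `α` is a refinement of `β` (`α ⪯ β`), that is,
every partial sum of `β` is a partial sum of `α`. (`Composition.boundaries` is the set of the
partial sums, including the empty and the full one.) -/
def Refines {n : ℕ} (α β : Composition n) : Prop :=
  β.boundaries ⊆ α.boundaries

/-- The exponent vector of the monomial `x_{i 0} ^ α_0 * x_{i 1} ^ α_1 * ⋯`. -/
def expo {n : ℕ} (α : Composition n) (i : Fin α.length → ℕ) : ℕ →₀ ℕ :=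
  ∑ j, Finsupp.single (i j) (α.blocksFun j)

/-! ### Quasisymmetric functions, as power series in `x_0, x_1, x_2, …` -/

/-- The monomial quasisymmetric function `M_α = ∑_{i_1 < ⋯ < i_k} x_{i_1} ^ α_1 ⋯ x_{i_k} ^ α_k`.
The parts of `α` are positive, so different sequences `i` give different monomials, and every
coefficient is `0` or `1`. -/
def monomialQ {n : ℕ} (α : Composition n) : MvPowerSeries ℕ ℚ :=
  fun m => if ∃ i : Fin α.length → ℕ, StrictMono i ∧ expo α i = m then 1 else 0

/-- The fundamental quasisymmetric function `F_α`, the sum of `M_β` over the refinements `β`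
of `α`. -/
def fundamentalQ {n : ℕ} (α : Composition n) : MvPowerSeries ℕ ℚ :=
  ∑ β : Composition n with Refines β α, monomialQ β

/-! ### Noncommutative symmetric functions -/

/-- `NSym = ℚ⟨H_1, H_2, …⟩`. -/
abbrev NSym : Type := FreeAlgebra ℚ ℕ+

/-- `H_m` for an integer `m`, where `H_0 = 1` and `H_m = 0` for negative `m`. -/
def H (m : ℤ) : NSym :=
  if h : 0 < m then FreeAlgebra.ι ℚ ⟨m.toNat, by omega⟩ else if m = 0 then 1 else 0

/-- The complete homogeneous function `H_α = H_{α_1} H_{α_2} ⋯ H_{α_k}`. -/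
def completeH {n : ℕ} (α : Composition n) : NSym :=
  (α.blocks.map fun a : ℕ => H (a : ℤ)).prod

/-- The ribbon function `R_α`, the sum of `(-1) ^ (ℓ(α) - ℓ(β)) H_β` over the coarsenings `β`
of `α`. -/
def ribbon {n : ℕ} (α : Composition n) : NSym :=
  ∑ β : Composition n with Refines α β, (-1 : ℚ) ^ (α.length - β.length) • completeH β

/-- The basis of `NSym` formed by the words in `H_1, H_2, …`. -/
abbrev wordBasis : Module.Basis (FreeMonoid ℕ+) ℚ NSym :=
  FreeAlgebra.basisFreeMonoid ℚ ℕ+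

/-- The size of a word in positive integers. -/
def wordSize (w : FreeMonoid ℕ+) : ℕ :=
  (w.toList.map fun a : ℕ+ => (a : ℕ)).sum

/-- A word in positive integers, seen as a composition of its size. -/
def wordComposition (w : FreeMonoid ℕ+) : Composition (wordSize w) where
  blocks := w.toList.map fun a : ℕ+ => (a : ℕ)
  blocks_pos := by
    intro i hi
    obtain ⟨a, -, rfl⟩ := List.mem_map.1 hi
    exact a.pos
  blocks_sum := rfl

/-- The pairing of `NSym` with quasisymmetric functions, for which `⟨H_α, f⟩` is the coefficient
of `x_0 ^ α_1 x_1 ^ α_2 ⋯ x_{k-1} ^ α_k` in `f`. On quasisymmetric `f` it is the bilinear pairing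
with `⟨H_α, M_β⟩ = δ_{α,β}`. -/
def pairing : NSym →ₗ[ℚ] MvPowerSeries ℕ ℚ →ₗ[ℚ] ℚ :=
  wordBasis.constr ℚ fun w =>
    MvPowerSeries.coeff (expo (wordComposition w) fun j => (j : ℕ))

/-- The operator `F^⊥` on `NSym`, which is `H ↦ ∑_γ ⟨H, F M_γ⟩ H_γ`. For `H = H_w`, only
compositions `γ` of size at most `|w|` contribute, for reasons of degree. -/
def perp (F : MvPowerSeries ℕ ℚ) : NSym →ₗ[ℚ] NSym :=
  wordBasis.constr ℚ fun w =>
    ∑ d ∈ Finset.range (wordSize w + 1), ∑ γ : Composition d,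
      pairing (wordBasis w) (F * monomialQ γ) • completeH γ

/-- The noncommutative Bernstein operator `𝔹_m = ∑_{i ≥ 0} (-1) ^ i H_{m+i} F_{1^i}^⊥`. On `H_w`,
the terms with `i > |w|` vanish for reasons of degree. -/
def bernstein (m : ℤ) : NSym →ₗ[ℚ] NSym :=
  wordBasis.constr ℚ fun w =>
    ∑ i ∈ Finset.range (wordSize w + 1),
      (-1 : ℚ) ^ i • (H (m + i) * perp (fundamentalQ (Composition.ones i)) (wordBasis w))

/-- The immaculate function `𝔖_a = 𝔹_{a_1} 𝔹_{a_2} ⋯ 𝔹_{a_m} (1)` of an integer vector `a`. -/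
def immaculateZ (a : List ℤ) : NSym :=
  a.foldr (fun m f => bernstein m f) 1

/-- The immaculate function `𝔖_α` of a composition `α`. -/
def immaculate {n : ℕ} (α : Composition n) : NSym :=
  immaculateZ (α.blocks.map fun a : ℕ => (a : ℤ))

/-! ### Standard immaculate tableaux -/

/-- The boxes of the diagram of `α`: the box `⟨i, j⟩` is in row `i` (counted from the top) and
column `j`, both numbered from `0`. -/
abbrev Box {n : ℕ} (α : Composition n) : Type :=
  (i : Fin α.length) × Fin (α.blocksFun i)

/-- The box of the first column in row `i`. -/
def firstBox {n : ℕ} (α : Composition n) (i : Fin α.length) : Box α :=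
  ⟨i, ⟨0, α.one_le_blocksFun i⟩⟩

/-- A standard immaculate tableau of shape `α`: a filling of the boxes of `α` in which each of the
`n` labels is used exactly once, weakly increasing along the rows and strictly increasing down the
first column. The labels are the elements of `Fin n`, the element `e` standing for the usual label
`e + 1`. -/
structure StandardTableau {n : ℕ} (α : Composition n) where
  label : Box α ≃ Fin n
  row_weak : ∀ (i : Fin α.length) (j j' : Fin (α.blocksFun i)),
    j ≤ j' → label ⟨i, j⟩ ≤ label ⟨i, j'⟩
  col_strict : ∀ i i' : Fin α.length,
    i < i' → label (firstBox α i) < label (firstBox α i')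

/-- The row of the box with usual label `k + 1`. -/
def StandardTableau.row {n : ℕ} {α : Composition n} (U : StandardTableau α) (k : Fin n) :
    Fin α.length :=
  (U.label.symm k).1

/-- The descent set: `d ∈ {1, …, n - 1}` is a descent if the usual label `d + 1` lies in a row
strictly below that of the usual label `d`. -/
def StandardTableau.descents {n : ℕ} {α : Composition n} (U : StandardTableau α) :
    Finset (Fin (n + 1)) :=
  {d | ∃ (_ : 0 < (d : ℕ)) (_ : (d : ℕ) < n),
    U.row ⟨(d : ℕ) - 1, by omega⟩ < U.row ⟨(d : ℕ), by omega⟩}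

/-- The composition `comp(S) = (s_1, s_2 - s_1, …, n - s_k)` of `n` given by a set
`S = {s_1 < ⋯ < s_k}` of integers between `1` and `n - 1`. -/
def comp {n : ℕ} (S : Finset (Fin (n + 1))) : Composition n :=
  CompositionAsSet.toComposition
    { boundaries := insert 0 (insert (Fin.last n) S)
      zero_mem := by simp
      getLast_mem := by simp }

/-- The descent composition of a standard immaculate tableau. -/
def StandardTableau.co {n : ℕ} {α : Composition n} (U : StandardTableau α) : Composition n :=
  comp U.descents

/-- `L_{α,β}`, the number of standard immaculate tableaux of shape `α` with descent
composition `β`. (There are finitely many.) -/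
def L {n : ℕ} (α β : Composition n) : ℕ :=
  Nat.card {U : StandardTableau α // U.co = β}

/-! ### The immaculate descent graph -/

/-- The immaculate descent graph `𝔇^n`, a simple directed graph (so without loops): there is an
edge from `α` to `β ≠ α` if some standard immaculate tableau of shape `α` has descent composition
`β`. The weight of the edge is `L α β`. -/
def descentGraph (n : ℕ) : Digraph (Composition n) where
  Adj α β := α ≠ β ∧ ∃ U : StandardTableau α, U.co = β

/-- A directed path from `u` to `v` in a digraph, given by the list of its (distinct) vertices.
For `u = v` this is the empty path, with the single vertex `u`. -/
def DiPath {V : Type*} (G : Digraph V) (u v : V) : Type _ :=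
  {p : {l : List V // l.Nodup} //
    p.1.IsChain G.Adj ∧ p.1.head? = some u ∧ p.1.getLast? = some v}

instance {V : Type*} [Fintype V] (G : Digraph V) (u v : V) : Fintype (DiPath G u v) := by
  unfold DiPath; infer_instance

/-- The list of the vertices of a path. -/
def DiPath.vertices {V : Type*} {G : Digraph V} {u v : V} (P : DiPath G u v) : List V := P.1.1

/-- The length `ℓ(P)` of a path, the number of its edges. -/
def DiPath.length {V : Type*} {G : Digraph V} {u v : V} (P : DiPath G u v) : ℕ :=
  P.vertices.tail.length

/-- `prod(P)`, the product of the weights of the edges of a path; it is `1` for the empty path. -/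
def DiPath.prod {V : Type*} {G : Digraph V} {u v : V} (wt : V → V → ℕ) (P : DiPath G u v) : ℕ :=
  (List.zipWith wt P.vertices P.vertices.tail).prod

/-- The coefficient `L^{-1}_{α,β} = ∑_P (-1) ^ ℓ(P) prod(P)`, the sum being over the directed paths
`P` from `α` to `β` in the immaculate descent graph. -/
def Linv {n : ℕ} (α β : Composition n) : ℤ :=
  ∑ P : DiPath (descentGraph n) α β, (-1 : ℤ) ^ P.length * (P.prod L : ℤ)

end Immaculate

end

/-!
The immaculate functions are shown to be related to the ribbon functions by
`R_β = ∑_α L_{α,β} 𝔖_α` (`ribbon_eq_sum`), and the matrix `L` to be unitriangular, with the signed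
path sums of the descent graph as its inverse (`sum_mul_pathSum`).

The first relation rests on the rule `𝔹_m(f) H_{s+1} = 𝔹_m(f H_{s+1}) + 𝔹_{m+1}(f) H_s`
(`bernstein_mul_H`), which holds because `F_{1^i}^⊥` acts on words in the `H` as the elementary
symmetric function of degree `i`, lowering `i` of the letters by one. Iterated, it gives the Pieri
rule for `𝔖_a H_s` (`bernsteinProd_mul_H`): `s` boxes are added in all ways to the rows of `a` and
to one new row. Listing the rows of the added boxes in weakly decreasing order, the Pieri rule
expands `H_β` as a sum over words, whose letters are the rows of the boxes in the order in which
they are added (`prod_H_eq_sum_words`). These words are the sequences of restricted growth with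
descents among the partial sums of `β`. A standard immaculate tableau is nothing but such a
sequence, the sequence of the rows of `1, 2, …, n`: the rows increase automatically once they are
sorted, and the condition on the first column is that of restricted growth. So
`H_β = ∑ 𝔖_{shape U}` over the tableaux `U` with descents among the partial sums of `β`
(`completeH_eq_sum`), and inclusion-exclusion leaves in `R_β` those with descent composition `β`.

For the second part, let `rank α = ∑ i α_i`, the rows being numbered from `0`. In a tableau, a run
between consecutive descents starts at most one new row, so that the row of a label is at most the
number of its run. Summed over the labels, this says that the rank of the shape is at most the rank
of the descent composition; equality forces every run to fill one row, so that both compositions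
are equal and the tableau is unique. Hence the rank increases along the edges of the descent graph,
and `L_{β,β} = 1`. Splitting off the first edge of a path gives the recursion of the inverse matrix.
-/

namespace Immaculate
open scoped Classical

/-! ### Monomial quasisymmetric functions -/

theorem expo_apply {n : ℕ} (α : Composition n) {i : Fin α.length → ℕ} (hi : StrictMono i)
    (j : Fin α.length) : expo α i (i j) = α.blocksFun j := by
  rw [expo, Finsupp.finsetSum_apply, Finset.sum_eq_single j]
  · simp
  · intro b _ hb
    exact Finsupp.single_eq_of_ne (fun h => hb (hi.injective h.symm))
  · simp

theorem expo_apply_of_notMem {n : ℕ} (α : Composition n) {i : Fin α.length → ℕ} {m : ℕ}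
    (hm : ∀ j, i j ≠ m) : expo α i m = 0 := by
  rw [expo, Finsupp.finsetSum_apply]
  exact Finset.sum_eq_zero fun j _ => Finsupp.single_eq_of_ne (hm j).symm

/-- The positions below `k` at which the exponent vector `q` does not vanish, in increasing
order. -/
def suppList (k : ℕ) (q : ℕ →₀ ℕ) : List ℕ := (List.range k).filter fun j => q j ≠ 0

theorem mem_suppList {k : ℕ} {q : ℕ →₀ ℕ} (hq : ∀ j, q j ≠ 0 → j < k) {m : ℕ} :
    m ∈ suppList k q ↔ q m ≠ 0 := by
  simp only [suppList, List.mem_filter, List.mem_range, decide_eq_true_eq]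
  exact ⟨fun h => h.2, fun h => ⟨hq m h, h⟩⟩

theorem sortedLT_suppList (k : ℕ) (q : ℕ →₀ ℕ) : (suppList k q).SortedLT :=
  (List.sortedLT_range k).pairwise.filter _ |>.sortedLT

/-- The monomial with exponent vector `q` occurs in `M_γ` exactly when `γ` lists the nonzero
entries of `q`. -/
theorem exists_expo_eq_iff {n k : ℕ} (γ : Composition n) {q : ℕ →₀ ℕ}
    (hq : ∀ j, q j ≠ 0 → j < k) :
    (∃ i : Fin γ.length → ℕ, StrictMono i ∧ expo γ i = q) ↔
      γ.blocks = (suppList k q).map q := by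
  constructor
  · rintro ⟨i, hi, rfl⟩
    have h : List.ofFn i = suppList k (expo γ i) := by
      refine List.SortedLT.eq_of_mem_iff hi.sortedLT_ofFn (sortedLT_suppList _ _) fun m => ?_
      rw [mem_suppList hq, List.mem_ofFn]
      constructor
      · rintro ⟨j, rfl⟩
        rw [expo_apply γ hi]
        exact Nat.one_le_iff_ne_zero.1 (γ.one_le_blocksFun j)
      · intro hm
        by_contra hc
        exact hm (expo_apply_of_notMem γ fun j hj => hc ⟨j, hj⟩)
    rw [← h, List.map_ofFn, ← γ.ofFn_blocksFun]
    congr 1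
    funext j
    exact (expo_apply γ hi j).symm
  · intro h
    have hl : γ.length = (suppList k q).length := by
      rw [← γ.blocks_length, h, List.length_map]
    have hi : StrictMono fun j : Fin γ.length => (suppList k q).get (Fin.cast hl j) := by
      intro a b hab
      exact (sortedLT_suppList k q).strictMono_get (by simpa using hab)
    refine ⟨_, hi, ?_⟩
    ext m
    by_cases hm : m ∈ suppList k q
    · obtain ⟨j, rfl⟩ := List.mem_iff_get.1 hm
      have := expo_apply γ hi (Fin.cast hl.symm j)
      simp only [Fin.cast_cast, Fin.cast_eq_self] at this
      rw [this]
      simp [Composition.blocksFun, h]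
    · rw [expo_apply_of_notMem]
      · rw [mem_suppList hq] at hm
        simpa using Eq.symm (not_not.1 hm)
      · rintro j rfl
        exact hm (List.get_mem _ _)

theorem monomialQ_apply {n k : ℕ} (γ : Composition n) {q : ℕ →₀ ℕ}
    (hq : ∀ j, q j ≠ 0 → j < k) :
    MvPowerSeries.coeff q (monomialQ γ) = if γ.blocks = (suppList k q).map q then 1 else 0 := by
  change (if _ then _ else _) = _
  simp only [exists_expo_eq_iff γ hq]

theorem H_zero : H 0 = 1 := by simp [H]

theorem H_coe (a : ℕ+) : H (a : ℕ) = FreeAlgebra.ι ℚ a := by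
  have : (0 : ℤ) < (a : ℕ) := by exact_mod_cast a.pos
  rw [H, dif_pos this]
  rfl

/-- The product `H_{q 0} H_{q 1} ⋯ H_{q (k - 1)}`. -/
noncomputable def prodH (k : ℕ) (q : ℕ →₀ ℕ) : NSym := ((List.range k).map fun j => H (q j : ℤ)).prod

theorem prodH_eq (k : ℕ) (q : ℕ →₀ ℕ) :
    prodH k q = (((suppList k q).map q).map fun a : ℕ => H (a : ℤ)).prod := by
  rw [prodH, suppList]
  generalize List.range k = l
  induction l with
  | nil => simp
  | cons a l ih =>
    by_cases ha : q a = 0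
    · simp [ha, ih, H_zero]
    · simp [ha, ih]

/-- Summing `M_γ`, weighted by `H_γ`, the coefficient of a monomial is the product of the `H`
at its exponents. -/
theorem sum_coeff_monomialQ_smul {N k : ℕ} {q : ℕ →₀ ℕ} (hq : ∀ j, q j ≠ 0 → j < k)
    (hN : ((suppList k q).map q).sum < N) :
    ∑ d ∈ Finset.range N, ∑ γ : Composition d,
      MvPowerSeries.coeff q (monomialQ γ) • completeH γ = prodH k q := by
  let γ₀ : Composition ((suppList k q).map q).sum :=
    { blocks := (suppList k q).map q
      blocks_pos := by
        intro i hi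
        obtain ⟨j, hj, rfl⟩ := List.mem_map.1 hi
        exact Nat.pos_of_ne_zero ((mem_suppList hq).1 hj)
      blocks_sum := rfl }
  rw [Finset.sum_sigma', Finset.sum_eq_single ⟨_, γ₀⟩]
  · rw [monomialQ_apply _ hq, if_pos rfl, one_smul, prodH_eq]
    rfl
  · rintro ⟨d, γ⟩ _ hne
    rw [monomialQ_apply _ hq, if_neg, zero_smul]
    intro h
    exact hne (Composition.sigma_eq_iff_blocks_eq.2 h)
  · intro h
    exact absurd (Finset.mem_sigma.2 ⟨Finset.mem_range.2 hN, Finset.mem_univ _⟩) h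

/-! ### The operators `F^⊥` on words -/

theorem wordBasis_eq (w : FreeMonoid ℕ+) :
    wordBasis w = FreeAlgebra.equivMonoidAlgebraFreeMonoid.symm (MonoidAlgebra.of ℚ _ w) := rfl

theorem wordBasis_one : wordBasis 1 = 1 := by
  rw [wordBasis_eq, map_one, map_one]

theorem wordBasis_mul_of (w : FreeMonoid ℕ+) (s : ℕ+) :
    wordBasis (w * FreeMonoid.of s) = wordBasis w * H (s : ℕ) := by
  rw [H_coe, wordBasis_eq, wordBasis_eq, map_mul, map_mul]
  congr 1
  simp [FreeAlgebra.equivMonoidAlgebraFreeMonoid]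

/-- The exponent vector of the monomial of a word, its `j`-th letter being the exponent of
`x_j`. -/
noncomputable def wordExpo (w : FreeMonoid ℕ+) : ℕ →₀ ℕ := expo (wordComposition w) fun j => (j : ℕ)

theorem wordExpo_apply (w : FreeMonoid ℕ+) (j : ℕ) :
    wordExpo w j = (w.toList.map fun a : ℕ+ => (a : ℕ)).getD j 0 := by
  by_cases hj : j < (wordComposition w).length
  · have := expo_apply (wordComposition w) (i := fun j => (j : ℕ)) (fun a b h => h) ⟨j, hj⟩
    refine this.trans ?_
    exact (List.getD_eq_getElem (wordComposition w).blocks 0 hj).symm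
  · rw [wordExpo, expo_apply_of_notMem]
    · rw [List.getD_eq_default]
      simpa [Composition.length, wordComposition] using hj
    · intro i hi
      exact hj (hi ▸ i.2)

theorem wordExpo_one : wordExpo 1 = 0 := by
  ext j; rw [wordExpo_apply]; simp

theorem wordExpo_mul_of (w : FreeMonoid ℕ+) (s : ℕ+) :
    wordExpo (w * FreeMonoid.of s) = wordExpo w + Finsupp.single w.length (s : ℕ) := by
  ext j
  simp only [wordExpo_apply, Finsupp.add_apply, FreeMonoid.toList_mul, FreeMonoid.toList_of,
    List.map_append, List.map_cons, List.map_nil]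
  have hl : w.length = (w.toList.map fun a : ℕ+ => (a : ℕ)).length := by
    simp [FreeMonoid.length]
  rw [hl]
  generalize (w.toList.map fun a : ℕ+ => (a : ℕ)) = l
  rcases lt_trichotomy j l.length with h | h | h
  · rw [List.getD_append _ _ _ _ h, Finsupp.single_eq_of_ne h.ne]; rfl
  · subst h; simp
  · rw [Finsupp.single_eq_of_ne h.ne', List.getD_eq_default, List.getD_eq_default]
    · rfl
    · exact h.le
    · rw [List.length_append]
      exact h

theorem wordExpo_lt {w : FreeMonoid ℕ+} {j : ℕ} (h : wordExpo w j ≠ 0) : j < w.length := by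
  by_contra hc
  rw [wordExpo_apply, List.getD_eq_default] at h
  · exact h rfl
  · simpa [FreeMonoid.length] using hc

/-- The operator `F^⊥` splits the exponents of a word between `F` and a product of the `H`: the sum
over `γ` in the definition of `F^⊥` collects the second factors. -/
theorem perp_wordBasis (F : MvPowerSeries ℕ ℚ) (w : FreeMonoid ℕ+) :
    perp F (wordBasis w) = ∑ x ∈ Finset.HasAntidiagonal.antidiagonal (wordExpo w),
      MvPowerSeries.coeff x.1 F • prodH w.length x.2 := by
  have hp (G : MvPowerSeries ℕ ℚ) :
      pairing (wordBasis w) G = MvPowerSeries.coeff (wordExpo w) G := by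
    rw [pairing, Module.Basis.constr_basis]; rfl
  rw [perp, Module.Basis.constr_basis]
  simp only [hp, MvPowerSeries.coeff_mul, Finset.sum_smul]
  rw [Finset.sum_congr rfl fun d _ => Finset.sum_comm, Finset.sum_comm]
  refine Finset.sum_congr rfl fun x hx => ?_
  have hx' : ∀ j, x.2 j ≤ wordExpo w j := fun j => by
    rw [← Finset.HasAntidiagonal.mem_antidiagonal.1 hx]; simp
  have hq : ∀ j, x.2 j ≠ 0 → j < w.length := fun j hj =>
    wordExpo_lt fun h => hj (Nat.le_zero.1 (h ▸ hx' j))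
  rw [← sum_coeff_monomialQ_smul (N := wordSize w + 1) hq]
  · simp only [Finset.smul_sum, mul_smul]
  · have hlen : w.length = (w.toList.map fun a : ℕ+ => (a : ℕ)).length := by
      simp [FreeMonoid.length]
    have h1 : ((suppList w.length x.2).map x.2).sum ≤ ((List.range w.length).map x.2).sum :=
      List.Sublist.sum_le_sum ((List.filter_sublist).map _) (by simp)
    have h2 : ((List.range w.length).map x.2).sum ≤
        ((List.range w.length).map (wordExpo w)).sum :=
      List.sum_le_sum fun j _ => hx' j
    have h3 : (List.range w.length).map (wordExpo w) = w.toList.map fun a : ℕ+ => (a : ℕ) := by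
      refine List.ext_getElem (by simp [hlen]) fun j h1 h2 => ?_
      simp only [List.getElem_map, List.getElem_range, wordExpo_apply]
      rw [List.getD_eq_getElem _ _ h2, List.getElem_map]
    rw [h3] at h2
    exact Nat.lt_succ_of_le (h1.trans h2)

theorem perp_one (F : MvPowerSeries ℕ ℚ) :
    perp F 1 = MvPowerSeries.coeff 0 F • 1 := by
  rw [← wordBasis_one, perp_wordBasis, wordExpo_one, Finsupp.antidiagonal_zero,
    Finset.sum_singleton, wordBasis_one]
  rfl

theorem prodH_add_single {k : ℕ} {q : ℕ →₀ ℕ} (hq : ∀ j, q j ≠ 0 → j < k) (b : ℕ) :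
    prodH (k + 1) (q + Finsupp.single k b) = prodH k q * H b := by
  have hk : q k = 0 := by by_contra h; exact (hq k h).false
  rw [prodH, List.range_succ, List.map_append, List.prod_append]
  congr 1
  · rw [prodH]
    congr 1
    refine List.map_congr_left fun j hj => ?_
    simp [(List.mem_range.1 hj).ne]
  · simp [hk]

theorem map_suppList_add_single {k : ℕ} {q : ℕ →₀ ℕ} (hq : ∀ j, q j ≠ 0 → j < k) (a : ℕ) :
    (suppList (k + 1) (q + Finsupp.single k a)).map (q + Finsupp.single k a) =
      (suppList k q).map q ++ if a = 0 then [] else [a] := by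
  have hk : q k = 0 := by by_contra h; exact (hq k h).false
  have h : ∀ j ∈ List.range k, (q + Finsupp.single k a) j = q j := fun j hj => by
    simp [(List.mem_range.1 hj).ne]
  rw [suppList, List.range_succ, List.filter_append, List.map_append, suppList]
  congr 1
  · rw [List.filter_congr fun j hj => by rw [h j hj]]
    exact List.map_congr_left fun j hj => h j (List.mem_of_mem_filter hj)
  · by_cases ha : a = 0 <;> simp [hk, ha]

/-- An exponent vector with a new coordinate `s` is split by splitting the old coordinates and `s`
independently. -/
theorem sum_antidiagonal_add_single {M : Type*} [AddCommMonoid M] {k s : ℕ} {e : ℕ →₀ ℕ}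
    (he : e k = 0) (g : (ℕ →₀ ℕ) × (ℕ →₀ ℕ) → M) :
    ∑ x ∈ Finset.HasAntidiagonal.antidiagonal (e + Finsupp.single k s), g x =
      ∑ x ∈ Finset.HasAntidiagonal.antidiagonal e,
        ∑ y ∈ Finset.HasAntidiagonal.antidiagonal s,
          g (x.1 + Finsupp.single k y.1, x.2 + Finsupp.single k y.2) := by
  rw [← Finset.sum_product']
  refine Finset.sum_nbij' (fun x => ((x.1.erase k, x.2.erase k), (x.1 k, x.2 k)))
    (fun z => (z.1.1 + Finsupp.single k z.2.1, z.1.2 + Finsupp.single k z.2.2)) ?_ ?_ ?_ ?_ ?_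
  · rintro ⟨p, q⟩ h
    rw [Finset.HasAntidiagonal.mem_antidiagonal] at h
    simp only [Finset.mem_product, Finset.HasAntidiagonal.mem_antidiagonal]
    constructor
    · ext j
      by_cases hj : j = k
      · subst hj; simp [he]
      · have := DFunLike.congr_fun h j
        simpa [hj] using this
    · simpa [he] using DFunLike.congr_fun h k
  · rintro ⟨⟨p, q⟩, a, b⟩ h
    simp only [Finset.mem_product, Finset.HasAntidiagonal.mem_antidiagonal] at h ⊢
    rw [← h.1, ← h.2, Finsupp.single_add]
    abel
  · rintro ⟨p, q⟩ _
    simp [Finsupp.erase_add_single]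
  · rintro ⟨⟨p, q⟩, a, b⟩ h
    simp only [Finset.mem_product, Finset.HasAntidiagonal.mem_antidiagonal] at h
    have := DFunLike.congr_fun h.1 k
    simp only [Finsupp.add_apply, he, Nat.add_eq_zero_iff] at this
    have hp : p.erase k = p := Finsupp.erase_of_notMem_support (by simp [this.1])
    have hq : q.erase k = q := Finsupp.erase_of_notMem_support (by simp [this.2])
    simp [Finsupp.erase_add, this.1, this.2]
  · rintro ⟨p, q⟩ _
    simp [Finsupp.erase_add_single]

/-- The elementary symmetric function `F_{1^i} = M_{1^i}`. -/
noncomputable abbrev elem (i : ℕ) : MvPowerSeries ℕ ℚ := fundamentalQ (Composition.ones i)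

theorem coeff_elem {i k : ℕ} {p : ℕ →₀ ℕ} (hp : ∀ j, p j ≠ 0 → j < k) :
    MvPowerSeries.coeff p (elem i) =
      if (suppList k p).map p = List.replicate i 1 then 1 else 0 := by
  -- The composition `1^i` has no proper refinement, so `F_{1^i} = M_{1^i}`.
  have h1 : (Composition.ones i).boundaries = Finset.univ := by
    rw [← Finset.card_eq_iff_eq_univ, Composition.card_boundaries_eq_succ_length]
    simp
  have h : ∀ β : Composition i, Refines β (Composition.ones i) ↔ β = Composition.ones i := by
    intro β
    rw [Refines, h1, Finset.univ_subset_iff, Composition.eq_ones_iff_length,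
      ← Finset.card_eq_iff_eq_univ, Composition.card_boundaries_eq_succ_length]
    simp
  rw [elem, fundamentalQ, Finset.sum_congr (Finset.filter_congr fun β _ => h β) fun _ _ => rfl,
    Finset.filter_eq', if_pos (Finset.mem_univ _), Finset.sum_singleton, monomialQ_apply _ hp,
    Composition.ones_blocks]
  simp only [eq_comm]

theorem freeMonoid_mul_of_induction {X : Type*} {P : FreeMonoid X → Prop} (one : P 1)
    (mul_of : ∀ w x, P w → P (w * FreeMonoid.of x)) (w : FreeMonoid X) : P w :=
  List.reverseRecOn (motive := P) w one mul_of

theorem prodH_wordExpo (w : FreeMonoid ℕ+) : prodH w.length (wordExpo w) = wordBasis w := by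
  induction w using freeMonoid_mul_of_induction with
  | one => rw [wordBasis_one]; rfl
  | mul_of w s ih =>
    have hl : (w * FreeMonoid.of s).length = w.length + 1 := by simp
    rw [hl, wordExpo_mul_of, prodH_add_single fun j hj => wordExpo_lt hj, ih, wordBasis_mul_of]

theorem perp_elem_zero (f : NSym) : perp (elem 0) f = f := by
  suffices perp (elem 0) = LinearMap.id by rw [this]; rfl
  refine wordBasis.ext fun w => ?_
  rw [perp_wordBasis, Finset.sum_eq_single (0, wordExpo w)]
  · rw [coeff_elem (k := 0) (by simp)]
    simp [suppList, prodH_wordExpo]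
  · rintro ⟨p, q⟩ hx hne
    rw [Finset.HasAntidiagonal.mem_antidiagonal] at hx
    dsimp only at hx ⊢
    have hp : ∀ j, p j ≠ 0 → j < w.length := fun j hj => wordExpo_lt (by rw [← hx]; simp [hj])
    rw [coeff_elem hp, if_neg, zero_smul]
    intro h
    rw [List.replicate_zero, List.map_eq_nil_iff, List.eq_nil_iff_forall_not_mem] at h
    have h0 : p = 0 := by
      ext j
      by_contra hj
      exact h j ((mem_suppList hp).2 hj)
    subst h0
    exact hne (by rw [← hx, zero_add])
  · simp

/-- The operators `F_{1^i}^⊥` act on a product with `H_s` as the elementary symmetric functions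
of one more variable. -/
theorem perp_elem_succ_mul (i : ℕ) (f : NSym) (s : ℕ) :
    perp (elem (i + 1)) (f * H (s + 1 : ℕ)) =
      perp (elem (i + 1)) f * H (s + 1 : ℕ) + perp (elem i) f * H s := by
  suffices perp (elem (i + 1)) ∘ₗ LinearMap.mulRight ℚ (H (s + 1 : ℕ)) =
      LinearMap.mulRight ℚ (H (s + 1 : ℕ)) ∘ₗ perp (elem (i + 1)) +
        LinearMap.mulRight ℚ (H s) ∘ₗ perp (elem i) from LinearMap.congr_fun this f
  refine wordBasis.ext fun w => ?_
  have hw := wordBasis_mul_of w s.succPNat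
  rw [Nat.succPNat_coe] at hw
  simp only [LinearMap.comp_apply, LinearMap.add_apply, LinearMap.mulRight_apply]
  rw [← hw]
  have he : wordExpo w w.length = 0 := by by_contra h; exact (wordExpo_lt h).false
  simp only [perp_wordBasis]
  rw [wordExpo_mul_of, sum_antidiagonal_add_single he, Finset.sum_mul, Finset.sum_mul,
    ← Finset.sum_add_distrib]
  refine Finset.sum_congr rfl fun ⟨p, q⟩ hx => ?_
  rw [Finset.HasAntidiagonal.mem_antidiagonal] at hx
  dsimp only at hx ⊢
  have hp : ∀ j, p j ≠ 0 → j < w.length := fun j hj => wordExpo_lt (by rw [← hx]; simp [hj])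
  have hq : ∀ j, q j ≠ 0 → j < w.length := fun j hj => wordExpo_lt (by rw [← hx]; simp [hj])
  have hp' (a : ℕ) : ∀ j, (p + Finsupp.single w.length a) j ≠ 0 → j < w.length + 1 := by
    intro j hj
    by_cases h : j = w.length
    · omega
    · exact (hp j (by simpa [h] using hj)).trans (Nat.lt_succ_self _)
  have hl : (w * FreeMonoid.of s.succPNat).length = w.length + 1 := by simp
  simp only [hl, prodH_add_single hq, coeff_elem (hp' _), map_suppList_add_single hp, coeff_elem hp]
  -- The new variable has exponent `0` or `1` in the monomials of `F_{1^(i+1)}`.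
  rw [Finset.Nat.sum_antidiagonal_eq_sum_range_succ_mk, Nat.succPNat_coe, Nat.succ_eq_add_one,
    Finset.sum_range_succ', Finset.sum_range_succ', Finset.sum_eq_zero, zero_add, add_comm]
  · congr 1
    · simp
    · simp [List.replicate_succ']
  · intro a _
    rw [if_neg, zero_smul]
    simp [List.replicate_succ']

/-! ### The Bernstein operators -/

theorem perp_elem_wordBasis_eq_zero (w : FreeMonoid ℕ+) :
    ∀ i, wordSize w < i → perp (elem i) (wordBasis w) = 0 := by
  induction w using freeMonoid_mul_of_induction with
  | one =>
    rintro (_ | i) hi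
    · simp at hi
    · rw [wordBasis_one, perp_one, coeff_elem (k := 0) (by simp), if_neg, zero_smul]
      simp [suppList, List.replicate_succ]
  | mul_of w s ih =>
    intro i hi
    have hs : wordSize (w * FreeMonoid.of s) = wordSize w + s := by simp [wordSize]
    have := s.pos
    obtain ⟨i, rfl⟩ : ∃ j, i = j + 1 := ⟨i - 1, by omega⟩
    obtain ⟨t, ht⟩ : ∃ t, (s : ℕ) = t + 1 := ⟨s - 1, by omega⟩
    rw [wordBasis_mul_of, ht, perp_elem_succ_mul, ih _ (by omega), ih _ (by omega), zero_mul,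
      zero_mul, add_zero]

/-- The range of summation in `𝔹_m H_w` may be enlarged; this gives words of different sizes a common
range. -/
theorem bernstein_wordBasis (m : ℤ) {w : FreeMonoid ℕ+} {N : ℕ} (hN : wordSize w < N) :
    bernstein m (wordBasis w) =
      ∑ i ∈ Finset.range N, (-1 : ℚ) ^ i • (H (m + i) * perp (elem i) (wordBasis w)) := by
  rw [bernstein, Module.Basis.constr_basis]
  refine Finset.sum_subset (Finset.range_subset_range.2 hN) fun i _ hi => ?_
  rw [Finset.mem_range, not_lt] at hi
  rw [perp_elem_wordBasis_eq_zero w i hi, mul_zero, smul_zero]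

theorem bernstein_one (m : ℤ) : bernstein m 1 = H m := by
  rw [← wordBasis_one, bernstein_wordBasis m (w := 1) (N := 1) (by simp [wordSize]), wordBasis_one]
  simp [perp_elem_zero]

/-- The commutation of a Bernstein operator with the right multiplication by `H_{s+1}`. -/
theorem bernstein_mul_H (m : ℤ) (f : NSym) (s : ℕ) :
    bernstein m f * H (s + 1 : ℕ) =
      bernstein m (f * H (s + 1 : ℕ)) + bernstein (m + 1) f * H s := by
  suffices LinearMap.mulRight ℚ (H (s + 1 : ℕ)) ∘ₗ bernstein m =
      bernstein m ∘ₗ LinearMap.mulRight ℚ (H (s + 1 : ℕ)) +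
        LinearMap.mulRight ℚ (H s) ∘ₗ bernstein (m + 1) from LinearMap.congr_fun this f
  refine wordBasis.ext fun w => ?_
  have hw := wordBasis_mul_of w s.succPNat
  rw [Nat.succPNat_coe] at hw
  simp only [LinearMap.comp_apply, LinearMap.add_apply, LinearMap.mulRight_apply]
  have hs : wordSize (w * FreeMonoid.of s.succPNat) = wordSize w + (s + 1) := by simp [wordSize]
  rw [← hw, bernstein_wordBasis (N := wordSize w + (s + 1) + 1) m (by omega),
    bernstein_wordBasis (N := wordSize w + (s + 1) + 1) m (by omega),
    bernstein_wordBasis (N := wordSize w + (s + 1)) (m + 1) (by omega), hw,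
    Finset.sum_range_succ', Finset.sum_range_succ' _ (wordSize w + (s + 1))]
  simp only [perp_elem_succ_mul, perp_elem_zero, add_mul, Finset.sum_mul, mul_add, smul_add,
    Finset.sum_add_distrib, smul_mul_assoc, mul_assoc]
  -- The terms with `H_s` on the right cancel against those of `𝔹_{m+1}`, shifted by one.
  have h : ∀ i ∈ Finset.range (wordSize w + (s + 1)),
      (-1 : ℚ) ^ (i + 1) • (H (m + (i + 1 : ℕ)) * (perp (elem i) (wordBasis w) * H s)) =
        -((-1 : ℚ) ^ i • (H (m + 1 + i) * (perp (elem i) (wordBasis w) * H s))) := by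
    intro i _
    rw [pow_succ, mul_neg_one, neg_smul, Nat.cast_succ, add_right_comm m 1, add_assoc m]
  rw [Finset.sum_congr rfl h, Finset.sum_neg_distrib]
  abel

/-! ### Immaculate functions and the Pieri rule -/

/-- The product `𝔹_{a_1} ⋯ 𝔹_{a_k}` of Bernstein operators, applied to `f`. -/
noncomputable def bernsteinProd (a : List ℕ) (f : NSym) : NSym :=
  a.foldr (fun (m : ℕ) g => bernstein m g) f

theorem bernsteinProd_append (a b : List ℕ) (f : NSym) :
    bernsteinProd (a ++ b) f = bernsteinProd a (bernsteinProd b f) := by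
  rw [bernsteinProd, List.foldr_append]; rfl

theorem bernsteinProd_cons (m : ℕ) (b : List ℕ) (f : NSym) :
    bernsteinProd (m :: b) f = bernstein m (bernsteinProd b f) := rfl

theorem bernsteinProd_add (a : List ℕ) (f g : NSym) :
    bernsteinProd a (f + g) = bernsteinProd a f + bernsteinProd a g := by
  induction a with
  | nil => rfl
  | cons m a ih => rw [bernsteinProd_cons, ih, map_add]; rfl

theorem bernsteinProd_singleton_zero : bernsteinProd [0] 1 = 1 :=
  (bernstein_one _).trans H_zero

theorem immaculate_eq {n : ℕ} (α : Composition n) : immaculate α = bernsteinProd α.blocks 1 := by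
  rw [immaculate, immaculateZ, List.foldr_map]; rfl

/-- Trailing zero rows do not change an immaculate function. -/
theorem bernsteinProd_range_of_le (c : ℕ → ℕ) {r K : ℕ} (hK : r ≤ K)
    (hc : ∀ j, r ≤ j → j < K → c j = 0) :
    bernsteinProd ((List.range K).map c) 1 = bernsteinProd ((List.range r).map c) 1 := by
  induction K, hK using Nat.le_induction with
  | base => rfl
  | succ K hK ih =>
    rw [List.range_succ, List.map_append, bernsteinProd_append,
      ← ih fun j h h' => hc j h (h'.trans (Nat.lt_succ_self K)), List.map_singleton,
      hc K hK (Nat.lt_succ_self K), bernsteinProd_singleton_zero]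

/-- The weakly increasing lists of `s` integers between `lo` and `lo + t`. -/
def increasing : (t lo s : ℕ) → Finset (List ℕ)
  | 0, lo, s => {List.replicate s lo}
  | _ + 1, _, 0 => {[]}
  | t + 1, lo, s + 1 =>
    (increasing (t + 1) lo s).image (lo :: ·) ∪ increasing t (lo + 1) (s + 1)

theorem mem_increasing {t lo s : ℕ} {v : List ℕ} :
    v ∈ increasing t lo s ↔
      v.length = s ∧ v.Pairwise (· ≤ ·) ∧ ∀ x ∈ v, lo ≤ x ∧ x ≤ lo + t := by
  induction t, lo, s using increasing.induct generalizing v with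
  | case1 lo s =>
    simp only [increasing, Finset.mem_singleton, List.eq_replicate_iff, add_zero,
      ← le_antisymm_iff]
    constructor
    · rintro ⟨h1, h2⟩
      refine ⟨h1, ?_, fun x hx => (h2 x hx).symm⟩
      exact List.Pairwise.imp_of_mem (R := fun _ _ => True)
        (fun ha hb _ => ((h2 _ ha).trans (h2 _ hb).symm).le) (List.pairwise_of_forall (by simp))
    · rintro ⟨h1, -, h2⟩
      exact ⟨h1, fun x hx => (h2 x hx).symm⟩
  | case2 lo t =>
    simp only [increasing, Finset.mem_singleton]
    constructor
    · rintro rfl; simp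
    · rintro ⟨h, -⟩; exact List.length_eq_zero_iff.1 h
  | case3 t lo s ih1 ih2 =>
    simp only [increasing, Finset.mem_union, Finset.mem_image, ih1, ih2]
    constructor
    · rintro (⟨v, ⟨h1, h2, h3⟩, rfl⟩ | ⟨h1, h2, h3⟩)
      · refine ⟨by simp [h1], List.pairwise_cons.2 ⟨fun x hx => (h3 x hx).1, h2⟩, ?_⟩
        intro x hx
        rcases List.mem_cons.1 hx with rfl | hx
        · omega
        · exact h3 x hx
      · exact ⟨h1, h2, fun x hx => by have := h3 x hx; omega⟩
    · rintro ⟨h1, h2, h3⟩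
      cases v with
      | nil => simp at h1
      | cons a v =>
        rw [List.pairwise_cons] at h2
        by_cases ha : a = lo
        · subst ha
          exact Or.inl ⟨v, ⟨by simpa using h1, h2.2, fun x hx => h3 x (by simp [hx])⟩, rfl⟩
        · refine Or.inr ⟨h1, List.pairwise_cons.2 h2, fun x hx => ?_⟩
          have h4 := h3 a (by simp)
          have h5 := h3 x hx
          rcases List.mem_cons.1 hx with rfl | hx
          · omega
          · have := h2.1 x hx; omega

/-- The Pieri rule with the first `lo` rows left untouched. The shape is given by the function `c` of
its row lengths, and `v` lists the rows of the added boxes. By `bernstein_mul_H`, either no further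
box is added to the row `lo`, or one is; this is the recursion that defines `increasing`. -/
theorem bernsteinProd_mul_H_aux (t lo s : ℕ) : ∀ c : ℕ → ℕ, c (lo + t) = 0 →
    bernsteinProd ((List.range lo).map c)
        (bernsteinProd ((List.range' lo t).map c) 1 * H (s : ℕ)) =
      ∑ v ∈ increasing t lo s,
        bernsteinProd ((List.range (lo + t + 1)).map fun j => c j + v.count j) 1 := by
  induction t, lo, s using increasing.induct with
  | case1 lo s =>
    intro c hc
    rw [increasing, Finset.sum_singleton, add_zero, List.range_succ, List.map_append,
      bernsteinProd_append]
    have h : (List.range lo).map (fun j => c j + (List.replicate s lo).count j) =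
        (List.range lo).map c := by
      refine List.map_congr_left fun j hj => ?_
      simp [List.count_replicate, (List.mem_range.1 hj).ne']
    rw [h]
    congr 1
    rw [add_zero] at hc
    simp only [List.range'_zero, List.map_nil, List.map_cons, List.count_replicate_self, hc,
      zero_add, bernsteinProd_cons]
    exact (one_mul _).trans (bernstein_one _).symm
  | case2 lo t =>
    intro c hc
    rw [increasing, Finset.sum_singleton]
    simp only [List.count_nil, add_zero, Nat.cast_zero, H_zero, mul_one]
    have h := List.range'_append (s := 0) (m := lo) (n := t + 1) (step := 1)
    simp only [zero_add, one_mul, ← List.range_eq_range'] at h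
    rw [← bernsteinProd_append, ← List.map_append, h]
    refine (bernsteinProd_range_of_le c (Nat.le_succ _) fun j hj hj' => ?_).symm
    rwa [Nat.lt_succ_iff.1 hj' |>.antisymm hj]
  | case3 t lo s ih1 ih2 =>
    intro c hc
    have hd : Disjoint ((increasing (t + 1) lo s).image (lo :: ·))
        (increasing t (lo + 1) (s + 1)) := by
      rw [Finset.disjoint_left]
      intro v hv hv'
      obtain ⟨v, -, rfl⟩ := Finset.mem_image.1 hv
      have := (mem_increasing.1 hv').2.2 lo (by simp)
      omega
    rw [increasing, Finset.sum_union hd, Finset.sum_image (by simp)]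
    have e1 : lo + (t + 1) = lo + 1 + t := by omega
    rw [List.range'_succ, List.map_cons, bernsteinProd_cons, bernstein_mul_H, bernsteinProd_add,
      add_comm]
    congr 1
    · let c' : ℕ → ℕ := fun j => c j + [lo].count j
      have hne : ∀ j, j ≠ lo → c' j = c j := fun j hj => by simp [c', List.count_singleton, hj.symm]
      have h := ih1 c' (by rw [hne _ (by omega), hc])
      have hlo : c' lo = c lo + 1 := by simp [c']
      rw [List.range'_succ, List.map_cons, bernsteinProd_cons, hlo,
        List.map_congr_left (g := c) (l := List.range lo)
          fun j hj => hne j (List.mem_range.1 hj).ne,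
        List.map_congr_left (g := c) (l := List.range' (lo + 1) t)
          fun j hj => hne j (by have := (List.mem_range'_1.1 hj).1; omega)] at h
      push_cast at h
      rw [h]
      refine Finset.sum_congr rfl fun v _ => ?_
      congr 2
      funext j
      simp only [c', List.count_cons, List.count_nil]
      omega
    · rw [e1] at hc ⊢
      rw [← ih2 c hc, List.range_succ, List.map_append, bernsteinProd_append]
      rfl

/-- The right Pieri rule for immaculate functions: `𝔖_a H_s` is the sum of the `𝔖_{a'}` over the
ways of adding `s` boxes to the rows of `a` and to one new row at the bottom. -/
theorem bernsteinProd_mul_H (k s : ℕ) (c : ℕ → ℕ) (hc : c k = 0) :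
    bernsteinProd ((List.range k).map c) 1 * H (s : ℕ) =
      ∑ v ∈ increasing k 0 s,
        bernsteinProd ((List.range (k + 1)).map fun j => c j + v.count j) 1 := by
  have := bernsteinProd_mul_H_aux k 0 s c (by rwa [zero_add])
  rwa [zero_add, ← List.range_eq_range'] at this

/-! ### Words of restricted growth -/

/-- Restricted growth of a word, read from its last letter to its first: every letter `x` is
preceded by all of `0, …, x - 1`. -/
def IsRG : List ℕ → Prop
  | [] => True
  | x :: w => (∀ y < x, y ∈ w) ∧ IsRG w

/-- The number of different letters of a word. For a word of restricted growth, the letters are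
`0, …, rows w - 1`. -/
def rows (w : List ℕ) : ℕ := w.toFinset.card

theorem IsRG.mem_iff {w : List ℕ} (hw : IsRG w) (y : ℕ) : y ∈ w ↔ y < rows w := by
  suffices ∃ r, ∀ y, y ∈ w ↔ y < r by
    obtain ⟨r, hr⟩ := this
    have : w.toFinset = Finset.range r := by ext y; simp [hr]
    rw [rows, this, Finset.card_range, hr]
  induction w with
  | nil => exact ⟨0, by simp⟩
  | cons x w ih =>
    obtain ⟨r, hr⟩ := ih hw.2
    have hx := hw.1
    simp only [hr] at hx
    by_cases hxr : x < r
    · refine ⟨r, fun y => ?_⟩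
      rw [List.mem_cons, hr]
      omega
    · obtain rfl : x = r := by
        by_contra hne
        exact (hx r (by omega)).false
      refine ⟨x + 1, fun y => ?_⟩
      rw [List.mem_cons, hr]
      omega

theorem rows_le_length (w : List ℕ) : rows w ≤ w.length := List.toFinset_card_le w

/-- A weakly increasing word can be put in front if its letters are old ones, or the next new one;
it suffices to check this for its last, largest letter. -/
theorem isRG_append {v w : List ℕ} (hv : v.Pairwise (· ≤ ·)) :
    IsRG (v ++ w) ↔ IsRG w ∧ ∀ x ∈ v, x ≤ rows w := by
  induction v with
  | nil => simp
  | cons x v ih =>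
    rw [List.pairwise_cons] at hv
    simp only [List.cons_append, IsRG, ih hv.2, List.mem_append, List.mem_cons, forall_eq_or_imp]
    constructor
    · rintro ⟨h1, h2, h3⟩
      refine ⟨h2, ?_, h3⟩
      by_contra hc
      rw [not_le] at hc
      rcases h1 _ hc with h | h
      · exact hc.not_ge (hv.1 _ h)
      · exact ((h2.mem_iff _).1 h).false
    · rintro ⟨h2, h1, h3⟩
      exact ⟨fun y hy => Or.inr ((h2.mem_iff y).2 (hy.trans_le h1)), h2, h3⟩

/-- The descents of a word, read from its last letter to its first, satisfy `P`; a descent is the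
number of letters before a letter that is larger than the one just before it. -/
def DescentsIn (P : ℕ → Prop) : List ℕ → Prop
  | [] => True
  | [_] => True
  | x :: y :: w => (y < x → P (w.length + 1)) ∧ DescentsIn P (y :: w)

theorem descentsIn_congr {P Q : ℕ → Prop} {w : List ℕ} (h : ∀ d < w.length, P d ↔ Q d) :
    DescentsIn P w ↔ DescentsIn Q w := by
  induction w using DescentsIn.induct with
  | case1 => rfl
  | case2 => rfl
  | case3 x y w ih =>
    simp only [DescentsIn]
    rw [h _ (by simp), ih fun d hd => h d (hd.trans (by simp))]

/-- If `P` holds at the boundary between `v` and `w` and nowhere inside `v`, the descents of `v ++ w`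
satisfy `P` exactly when `v` has none and those of `w` do. -/
theorem descentsIn_append {P Q : ℕ → Prop} {v w : List ℕ} (hv : v ≠ []) (h0 : P w.length)
    (h1 : ∀ d, w.length < d → d < w.length + v.length → ¬ P d)
    (h2 : ∀ d < w.length, P d ↔ Q d) :
    DescentsIn P (v ++ w) ↔ v.Pairwise (· ≤ ·) ∧ DescentsIn Q w := by
  rw [← descentsIn_congr h2, ← List.isChain_iff_pairwise]
  induction v using DescentsIn.induct with
  | case1 => exact absurd rfl hv
  | case2 x =>
    cases w with
    | nil => simp [DescentsIn]
    | cons y w =>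
      rw [List.length_cons] at h0
      simp [DescentsIn, h0]
  | case3 x y v ih =>
    have := ih (by simp) fun d hd hd' => h1 d hd (hd'.trans (by simp))
    simp only [List.cons_append, DescentsIn, List.isChain_cons_cons] at this ⊢
    have h := h1 ((v ++ w).length + 1) (by rw [List.length_append]; omega)
      (by simp only [List.length_append, List.length_cons]; omega)
    rw [this, imp_iff_not h, not_lt, and_assoc]

/-- The sums of the final segments of a list. -/
def IsSuffixSum (bs : List ℕ) (d : ℕ) : Prop := ∃ i, (bs.drop i).sum = d

theorem isSuffixSum_cons {b : ℕ} {bs : List ℕ} {d : ℕ} :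
    IsSuffixSum (b :: bs) d ↔ b + bs.sum = d ∨ IsSuffixSum bs d := by
  constructor
  · rintro ⟨_ | i, h⟩
    · exact Or.inl (by simpa using h)
    · exact Or.inr ⟨i, h⟩
  · rintro (h | ⟨i, h⟩)
    · exact ⟨0, by simpa using h⟩
    · exact ⟨i + 1, h⟩

theorem isSuffixSum_sum (bs : List ℕ) : IsSuffixSum bs bs.sum := ⟨0, rfl⟩

theorem IsSuffixSum.le_sum {bs : List ℕ} {d : ℕ} (h : IsSuffixSum bs d) : d ≤ bs.sum := by
  obtain ⟨i, rfl⟩ := h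
  exact (List.drop_sublist i bs).sum_le_sum (by simp)

/-- The words obtained by writing, in front of the empty word, weakly increasing words whose
lengths are the elements of `bs`, taken from the last one to the first, and whose letters do not
exceed the number of letters used before. -/
def words : List ℕ → Finset (List ℕ)
  | [] => {[]}
  | b :: bs => (words bs).biUnion fun w => (increasing (rows w) 0 b).image (· ++ w)

/-- The blocks of weakly increasing letters in `words` turn into a condition on the descents of the
whole word, which no longer refers to the blocks. -/
theorem mem_words {bs : List ℕ} (hbs : ∀ b ∈ bs, 0 < b) {u : List ℕ} :
    u ∈ words bs ↔ IsRG u ∧ u.length = bs.sum ∧ DescentsIn (IsSuffixSum bs) u := by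
  induction bs generalizing u with
  | nil =>
    simp only [words, Finset.mem_singleton, List.sum_nil, List.length_eq_zero_iff]
    constructor
    · rintro rfl; simp [IsRG, DescentsIn]
    · exact fun h => h.2.1
  | cons b bs ih =>
    simp only [List.mem_cons, forall_eq_or_imp] at hbs
    have key : ∀ v w : List ℕ, v.length = b → w.length = bs.sum →
        (DescentsIn (IsSuffixSum (b :: bs)) (v ++ w) ↔
          v.Pairwise (· ≤ ·) ∧ DescentsIn (IsSuffixSum bs) w) := by
      intro v w hv hw
      refine descentsIn_append ?_ ?_ ?_ ?_
      · rintro rfl; simp at hv; omega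
      · rw [hw]; exact isSuffixSum_cons.2 (Or.inr (isSuffixSum_sum bs))
      · intro d h1 h2 h
        rcases isSuffixSum_cons.1 h with h | h
        · omega
        · have := h.le_sum; omega
      · intro d hd
        rw [isSuffixSum_cons, or_iff_right]
        omega
    simp only [words, Finset.mem_biUnion, Finset.mem_image, ih hbs.2, mem_increasing,
      List.sum_cons]
    constructor
    · rintro ⟨w, ⟨h1, h2, h3⟩, v, ⟨h4, h5, h6⟩, rfl⟩
      refine ⟨(isRG_append h5).2 ⟨h1, fun x hx => by simpa using (h6 x hx).2⟩, ?_,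
        (key v w h4 h2).2 ⟨h5, h3⟩⟩
      rw [List.length_append, h4, h2]
    · rintro ⟨h1, h2, h3⟩
      obtain ⟨v, w, rfl, hv⟩ : ∃ v w, u = v ++ w ∧ v.length = b :=
        ⟨u.take b, u.drop b, (List.take_append_drop b u).symm, by simp; omega⟩
      rw [List.length_append] at h2
      have hw : w.length = bs.sum := by omega
      obtain ⟨h4, h5⟩ := (key v w hv hw).1 h3
      obtain ⟨h6, h7⟩ := (isRG_append h4).1 h1
      exact ⟨w, ⟨h6, hw, h5⟩, v, ⟨hv, h4, fun x hx => by simpa using h7 x hx⟩, rfl⟩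

/-- The immaculate function whose rows are the multiplicities of the letters of a word. The rows
beyond the largest letter are zero and have no effect. -/
noncomputable def wordImmaculate (w : List ℕ) : NSym :=
  bernsteinProd ((List.range w.length).map fun j => w.count j) 1

theorem wordImmaculate_eq {w : List ℕ} {K : ℕ} (hK : K ≤ w.length)
    (hw : ∀ y ∈ w, y < K) :
    wordImmaculate w = bernsteinProd ((List.range K).map fun j => w.count j) 1 := by
  exact bernsteinProd_range_of_le _ hK fun j hj _ =>
    List.count_eq_zero.2 fun h => (hw j h).not_ge hj

/-- The Pieri rule, iterated: a product of complete homogeneous functions is a sum of immaculate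
functions over words. -/
theorem prod_H_eq_sum_words {bs : List ℕ} (hbs : ∀ b ∈ bs, 0 < b) :
    (bs.reverse.map fun a : ℕ => H (a : ℤ)).prod = ∑ w ∈ words bs, wordImmaculate w := by
  induction bs with
  | nil => simp [words, wordImmaculate, bernsteinProd]
  | cons b bs ih =>
    have hbs' : ∀ b ∈ bs, 0 < b := fun a ha => hbs a (List.mem_cons_of_mem _ ha)
    rw [words, Finset.sum_biUnion, List.reverse_cons, List.map_append, List.prod_append, ih hbs',
      Finset.sum_mul]
    · refine Finset.sum_congr rfl fun w hw => ?_
      obtain ⟨hrg, -, -⟩ := (mem_words hbs').1 hw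
      rw [Finset.sum_image (by simp), wordImmaculate_eq (rows_le_length w)
          fun y hy => (hrg.mem_iff y).1 hy, List.map_singleton, List.prod_singleton,
        bernsteinProd_mul_H]
      · refine Finset.sum_congr rfl fun v hv => ?_
        rw [wordImmaculate_eq (K := rows w + 1)]
        · simp only [List.count_append, add_comm]
        · have := rows_le_length w
          have := hbs b List.mem_cons_self
          rw [List.length_append, (mem_increasing.1 hv).1]
          omega
        · intro y hy
          rcases List.mem_append.1 hy with hy | hy
          · have := ((mem_increasing.1 hv).2.2 y hy).2
            omega
          · exact ((hrg.mem_iff y).1 hy).trans (Nat.lt_succ_self _)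
      · rw [List.count_eq_zero, hrg.mem_iff]
        exact lt_irrefl _
    · intro w _ w' _ hne
      rw [Function.onFun, Finset.disjoint_left]
      rintro u hu hu'
      obtain ⟨v, hv, rfl⟩ := Finset.mem_image.1 hu
      obtain ⟨v', hv', h⟩ := Finset.mem_image.1 hu'
      refine hne (List.append_inj h ?_).2.symm
      rw [(mem_increasing.1 hv).1, (mem_increasing.1 hv').1]

/-! ### Standard immaculate tableaux as words -/

theorem count_ofFn {m : ℕ} (f : Fin m → ℕ) (y : ℕ) :
    (List.ofFn f).count y = (Finset.univ.filter fun k => f k = y).card := by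
  induction m with
  | zero => simp
  | succ m ih =>
    rw [List.ofFn_succ, List.count_cons, ih, Fin.card_filter_univ_succ]
    split_ifs <;> simp_all

namespace StandardTableau

variable {n : ℕ} {α : Composition n}

theorem row_label (U : StandardTableau α) (b : Box α) : U.row (U.label b) = b.1 := by
  rw [row, Equiv.symm_apply_apply]

theorem strictMono_label (U : StandardTableau α) (i : Fin α.length) :
    StrictMono fun j : Fin (α.blocksFun i) => U.label ⟨i, j⟩ := by
  refine Monotone.strictMono_of_injective (fun j j' h => U.row_weak i j j' h) fun j j' h => ?_
  simpa using U.label.injective h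

theorem range_label (U : StandardTableau α) (i : Fin α.length) :
    Set.range (fun j : Fin (α.blocksFun i) => U.label ⟨i, j⟩) = {k | U.row k = i} := by
  ext k
  constructor
  · rintro ⟨j, rfl⟩
    exact U.row_label _
  · rintro rfl
    exact ⟨(U.label.symm k).2, by simp [row]⟩

/-- A standard immaculate tableau is determined by the rows of its labels. -/
theorem row_injective : Function.Injective (row : StandardTableau α → Fin n → Fin α.length) := by
  intro U V h
  have : U.label = V.label := by
    ext ⟨i, j⟩ : 1
    have := ((U.strictMono_label i).range_inj (V.strictMono_label i)).1
      (by rw [range_label, range_label, h])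
    exact congrFun this j
  cases U; cases V; cases this; rfl

theorem card_row_eq (U : StandardTableau α) (i : Fin α.length) :
    (Finset.univ.filter fun k => U.row k = i).card = α.blocksFun i := by
  rw [Finset.card_filter, ← Equiv.sum_comp U.label]
  simp only [row_label]
  rw [Fintype.sum_sigma, Finset.sum_eq_single i]
  · simp
  · intro j _ hj
    simp [hj]
  · simp

theorem exists_lt_row_eq (U : StandardTableau α) (k : Fin n) (i : Fin α.length)
    (hi : i < U.row k) : ∃ k' < k, U.row k' = i := by
  refine ⟨U.label (firstBox α i), (U.col_strict _ _ hi).trans_le ?_, U.row_label _⟩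
  have : k = U.label ⟨U.row k, (U.label.symm k).2⟩ := by simp [row]
  conv_rhs => rw [this]
  exact U.row_weak _ _ _ (Nat.zero_le _)

/-- Conversely, an assignment of rows to the labels comes from a tableau if it fills the rows and
every row starts after the rows above it. -/
theorem exists_row_eq (f : Fin n → Fin α.length)
    (hcard : ∀ i, (Finset.univ.filter fun k => f k = i).card = α.blocksFun i)
    (hf : ∀ k, ∀ i < f k, ∃ k' < k, f k' = i) : ∃ U : StandardTableau α, U.row = f := by
  -- Each row is filled with its labels in increasing order.
  let e (i : Fin α.length) := (Finset.univ.filter fun k => f k = i).orderEmbOfFin (hcard i)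
  have he (i j) : f (e i j) = i :=
    (Finset.mem_filter.1 (Finset.orderEmbOfFin_mem _ (hcard i) j)).2
  have hinj : Function.Injective fun b : Box α => e b.1 b.2 := by
    rintro ⟨i, j⟩ ⟨i', j'⟩ h
    dsimp only at h
    obtain rfl : i = i' := by rw [← he i j, h, he]
    rw [(e i).injective h]
  have hbij : Function.Bijective fun b : Box α => e b.1 b.2 := by
    rw [Fintype.bijective_iff_injective_and_card]
    refine ⟨hinj, ?_⟩
    rw [Fintype.card_sigma]
    simp [α.sum_blocksFun]
  have hlab (b : Box α) : f (Equiv.ofBijective _ hbij b) = b.1 := he _ _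
  refine ⟨⟨Equiv.ofBijective _ hbij, fun i j j' h => (e i).monotone h, ?_⟩, ?_⟩
  · intro i i' hi
    obtain ⟨k, hk, hki⟩ := hf (Equiv.ofBijective _ hbij (firstBox α i')) i (by rwa [hlab])
    refine lt_of_le_of_lt ?_ hk
    obtain ⟨⟨i₀, j⟩, rfl⟩ := hbij.2 k
    obtain rfl : i₀ = i := by rw [← hki]; exact (he _ _).symm
    exact (e i₀).monotone (Nat.zero_le _)
  · funext k
    obtain ⟨b, rfl⟩ := (Equiv.ofBijective _ hbij).surjective k
    rw [row_label, hlab]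

instance : Finite (StandardTableau α) := Finite.of_injective _ row_injective

noncomputable instance : Fintype (StandardTableau α) := Fintype.ofFinite _

/-- The word of the rows of the labels `n, n - 1, …, 1`. -/
def word (U : StandardTableau α) : List ℕ := (List.ofFn fun k => (U.row k : ℕ)).reverse

theorem length_word (U : StandardTableau α) : U.word.length = n := by simp [word]

theorem getElem_word (U : StandardTableau α) (i : ℕ) (hi : i < U.word.length) :
    U.word[i] = U.row ⟨n - 1 - i, by rw [length_word] at hi; omega⟩ := by
  simp [word]

theorem mem_word (U : StandardTableau α) (y : ℕ) : y ∈ U.word ↔ y < α.length := by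
  rw [word, List.mem_reverse, List.mem_ofFn]
  constructor
  · rintro ⟨k, rfl⟩
    exact (U.row k).2
  · intro hy
    exact ⟨U.label (firstBox α ⟨y, hy⟩), by rw [row_label]; rfl⟩

theorem count_word (U : StandardTableau α) (i : Fin α.length) :
    U.word.count (i : ℕ) = α.blocksFun i := by
  rw [word, List.count_reverse, count_ofFn, ← U.card_row_eq i]
  simp only [Fin.ext_iff]

theorem map_count_word (U : StandardTableau α) :
    ((List.range α.length).map fun j => U.word.count j) = α.blocks := by
  refine List.ext_getElem (by simp) fun j h1 h2 => ?_
  rw [List.getElem_map, List.getElem_range]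
  exact U.count_word ⟨j, h2⟩

theorem wordImmaculate_word (U : StandardTableau α) : wordImmaculate U.word = immaculate α := by
  rw [wordImmaculate_eq (by rw [length_word]; exact α.length_le) fun y => (U.mem_word y).1,
    map_count_word, immaculate_eq]

end StandardTableau

theorem isRG_iff {w : List ℕ} :
    IsRG w ↔ ∀ i (h : i < w.length), ∀ y < w[i], ∃ j, ∃ h' : j < w.length, i < j ∧ w[j] = y := by
  induction w with
  | nil => simp [IsRG]
  | cons x w ih =>
    rw [IsRG, ih]
    constructor
    · rintro ⟨h1, h2⟩ (_ | i) hi y hy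
      · obtain ⟨j, hj, rfl⟩ := List.mem_iff_getElem.1 (h1 y hy)
        exact ⟨j + 1, by simpa using hj, by omega, rfl⟩
      · obtain ⟨j, hj, hij, rfl⟩ := h2 i (by simpa using hi) y hy
        exact ⟨j + 1, by simpa using hj, by omega, rfl⟩
    · intro h
      constructor
      · intro y hy
        obtain ⟨_ | j, hj, hij, hjy⟩ := h 0 (by simp) y hy
        · omega
        · rw [← hjy]
          exact List.getElem_mem _
      · intro i hi y hy
        obtain ⟨_ | j, hj, hij, hjy⟩ := h (i + 1) (by simpa using hi) y hy
        · omega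
        · exact ⟨j, by simpa using hj, by omega, hjy⟩

theorem descentsIn_iff {P : ℕ → Prop} {w : List ℕ} :
    DescentsIn P w ↔
      ∀ i (h : i + 1 < w.length), w[i + 1] < w[i] → P (w.length - 1 - i) := by
  induction w using DescentsIn.induct with
  | case1 => simp [DescentsIn]
  | case2 => simp [DescentsIn]
  | case3 x y w ih =>
    rw [DescentsIn, ih]
    constructor
    · rintro ⟨h1, h2⟩ (_ | i) hi h
      · exact h1 h
      · have := h2 i (by simpa using hi) h
        simpa [Nat.sub_sub, add_comm] using this
    · intro h
      refine ⟨fun hyx => h 0 (by simp) hyx, fun i hi hlt => ?_⟩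
      have := h (i + 1) (by simpa using hi) hlt
      simpa [Nat.sub_sub, add_comm] using this

namespace StandardTableau

variable {n : ℕ} {α : Composition n}

theorem isRG_word (U : StandardTableau α) : IsRG U.word := by
  rw [isRG_iff]
  intro i hi y hy
  rw [getElem_word] at hy
  rw [length_word] at hi
  obtain ⟨k, hk, hky⟩ := U.exists_lt_row_eq _ ⟨y, hy.trans (Fin.is_lt _)⟩ hy
  rw [Fin.lt_def] at hk
  dsimp only at hk
  refine ⟨n - 1 - k, by rw [length_word]; omega, by omega, ?_⟩
  have h : (⟨n - 1 - (n - 1 - k), by omega⟩ : Fin n) = k := Fin.ext (by dsimp only; omega)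
  rw [getElem_word, h, hky]

theorem mem_descents (U : StandardTableau α) (d : Fin (n + 1)) :
    d ∈ U.descents ↔ ∃ (_ : 0 < (d : ℕ)) (_ : (d : ℕ) < n),
      U.row ⟨(d : ℕ) - 1, by omega⟩ < U.row ⟨(d : ℕ), by omega⟩ := by
  simp [descents]

/-- The descents of a tableau are those of its word. -/
theorem descentsIn_word (U : StandardTableau α) (P : ℕ → Prop) :
    DescentsIn P U.word ↔ ∀ d ∈ U.descents, P d := by
  rw [descentsIn_iff]
  simp only [getElem_word, length_word, mem_descents]
  constructor
  · rintro h d ⟨h1, h2, h3⟩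
    have := h (n - 1 - d) (by omega)
    have e1 : n - 1 - (n - 1 - (d : ℕ) + 1) = d - 1 := by omega
    have e2 : n - 1 - (n - 1 - (d : ℕ)) = d := by omega
    simp only [e1, e2] at this
    exact this h3
  · intro h i hi hlt
    have e1 : n - 1 - (i + 1) = n - 1 - i - 1 := by omega
    simp only [e1] at hlt
    exact h ⟨n - 1 - i, by omega⟩ ⟨by dsimp only; omega, by dsimp only; omega, hlt⟩

/-- The shape of a tableau and the tableau itself are determined by its word. -/
theorem word_injective :
    Function.Injective fun x : (α : Composition n) × StandardTableau α => x.2.word := by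
  rintro ⟨α, U⟩ ⟨α', U'⟩ h
  dsimp only at h
  have hl : α.length = α'.length := by
    refine eq_of_forall_lt_iff fun y => ?_
    rw [← U.mem_word, h, U'.mem_word]
  obtain rfl : α = α' := by
    ext1
    rw [← U.map_count_word, ← U'.map_count_word, h, hl]
  congr 1
  refine row_injective (funext fun k => Fin.ext ?_)
  exact congrFun (List.ofFn_injective (List.reverse_injective h)) k

/-- Every word of restricted growth is the word of a tableau. -/
theorem exists_word_eq {w : List ℕ} (hw : IsRG w) (hn : w.length = n) :
    ∃ (α : Composition n) (U : StandardTableau α), U.word = w := by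
  let α : Composition n :=
    { blocks := (List.range (rows w)).map fun j => w.count j
      blocks_pos := by
        intro i hi
        obtain ⟨j, hj, rfl⟩ := List.mem_map.1 hi
        exact List.count_pos_iff.2 ((hw.mem_iff j).2 (List.mem_range.1 hj))
      blocks_sum := by
        have h : w.toFinset = Finset.range (rows w) := by ext y; simp [hw.mem_iff]
        rw [← hn, ← List.sum_toFinset_count_eq_length, h]
        rfl }
  have hl : α.length = rows w := by simp [Composition.length, α]
  let f : Fin n → Fin α.length := fun k => ⟨w[n - 1 - k], by
    rw [hl, ← hw.mem_iff]; exact List.getElem_mem _⟩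
  have hfw : (List.ofFn fun k => (f k : ℕ)).reverse = w := by
    refine List.ext_getElem (by simp [hn]) fun i h1 h2 => ?_
    have : n - 1 - (n - 1 - i) = i := by omega
    simp [f, this]
  have hcard (i : Fin α.length) :
      (Finset.univ.filter fun k => f k = i).card = α.blocksFun i := by
    have : α.blocksFun i = w.count (i : ℕ) := by simp [Composition.blocksFun, α]
    rw [this, ← hfw, List.count_reverse, count_ofFn]
    simp only [Fin.ext_iff]
  have hf (k : Fin n) : ∀ i < f k, ∃ k' < k, f k' = i := by
    intro i hi
    obtain ⟨j, hj, hkj, h⟩ := isRG_iff.1 hw (n - 1 - k) (by omega) i hi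
    refine ⟨⟨n - 1 - j, by omega⟩, ?_, ?_⟩
    · rw [Fin.lt_def]; dsimp only; omega
    · have : n - 1 - (n - 1 - j) = j := by omega
      exact Fin.ext (by simp [f, this, h])
  obtain ⟨U, hU⟩ := exists_row_eq f hcard hf
  exact ⟨α, U, by rw [word, hU, hfw]⟩

end StandardTableau

/-- The partial sums of `β` are the sums of the final segments of the reversed list of its parts, the
order in which `words` takes them. -/
theorem mem_boundaries_iff {n : ℕ} (β : Composition n) (d : Fin (n + 1)) :
    d ∈ β.boundaries ↔ IsSuffixSum β.blocks.reverse d := by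
  simp only [Composition.boundaries, Finset.mem_map, Finset.mem_univ, true_and, IsSuffixSum,
    List.drop_reverse, List.sum_reverse]
  constructor
  · rintro ⟨i, rfl⟩
    refine ⟨β.length - i, ?_⟩
    rw [β.blocks_length, Nat.sub_sub_self (Nat.lt_succ_iff.1 i.2)]
    rfl
  · rintro ⟨i, hi⟩
    refine ⟨⟨β.length - i, by omega⟩, Fin.ext ?_⟩
    rw [← hi]
    rfl

/-- The expansion of the complete homogeneous functions in the immaculate functions. -/
theorem completeH_eq_sum {n : ℕ} (β : Composition n) :
    completeH β = ∑ α : Composition n, ∑ U : StandardTableau α with U.descents ⊆ β.boundaries,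
      immaculate α := by
  have hpos : ∀ b ∈ β.blocks.reverse, 0 < b := fun b hb =>
    β.blocks_pos (List.mem_reverse.1 hb)
  have h := prod_H_eq_sum_words hpos
  rw [List.reverse_reverse] at h
  rw [completeH, h, Finset.sum_sigma']
  symm
  refine Finset.sum_bij (fun x _ => x.2.word) ?_ ?_ ?_ ?_
  · rintro ⟨α, U⟩ hx
    simp only [Finset.mem_sigma, Finset.mem_univ, true_and, Finset.mem_filter] at hx
    refine (mem_words hpos).2 ⟨U.isRG_word, by simp [U.length_word], ?_⟩
    rw [U.descentsIn_word]
    exact fun d hd => (mem_boundaries_iff β d).1 (hx hd)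
  · exact fun x _ y _ hxy => StandardTableau.word_injective hxy
  · intro w hw
    obtain ⟨h1, h2, h3⟩ := (mem_words hpos).1 hw
    obtain ⟨α, U, rfl⟩ := StandardTableau.exists_word_eq (n := n) h1 (by simpa using h2)
    refine ⟨⟨α, U⟩, ?_, rfl⟩
    simp only [Finset.mem_sigma, Finset.mem_univ, true_and, Finset.mem_filter]
    exact fun d hd => (mem_boundaries_iff β d).2 ((U.descentsIn_word _).1 h3 d hd)
  · rintro ⟨α, U⟩ _
    exact U.wordImmaculate_word.symm

/-! ### Compositions and their boundaries -/

theorem boundaries_injective {n : ℕ} :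
    Function.Injective (Composition.boundaries : Composition n → Finset (Fin (n + 1))) := by
  intro α β h
  refine (compositionEquiv n).injective ?_
  ext1
  simpa [compositionEquiv] using h

theorem boundaries_comp {n : ℕ} (S : Finset (Fin (n + 1))) :
    (comp S).boundaries = insert 0 (insert (Fin.last n) S) :=
  CompositionAsSet.toComposition_boundaries _

theorem zero_mem_boundaries {n : ℕ} (β : Composition n) : 0 ∈ β.boundaries :=
  β.toCompositionAsSet.zero_mem

theorem last_mem_boundaries {n : ℕ} (β : Composition n) : Fin.last n ∈ β.boundaries :=
  β.toCompositionAsSet.getLast_mem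

theorem boundaries_comp_subset {n : ℕ} (S : Finset (Fin (n + 1))) (β : Composition n) :
    (comp S).boundaries ⊆ β.boundaries ↔ S ⊆ β.boundaries := by
  simp [boundaries_comp, Finset.insert_subset_iff, zero_mem_boundaries, last_mem_boundaries]

/-! ### Ribbon functions in terms of immaculate functions -/

/-- Inclusion and exclusion over the compositions between `δ` and `α` in the refinement order. -/
theorem sum_neg_one_pow_length {n : ℕ} (δ α : Composition n) :
    ∑ β : Composition n with Refines α β ∧ Refines β δ, (-1 : ℚ) ^ (α.length - β.length) =
      if δ = α then 1 else 0 := by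
  by_cases hδ : Refines α δ
  -- The intermediate compositions have the boundaries of `α` outside of `S`, where `S` is any set
  -- of boundaries of `α` that are not boundaries of `δ`.
  · have h0 : ∀ {S}, S ⊆ α.boundaries \ δ.boundaries → δ.boundaries ⊆ α.boundaries \ S := by
      intro S hS x hx
      refine Finset.mem_sdiff.2 ⟨hδ hx, fun h => ?_⟩
      exact (Finset.mem_sdiff.1 (hS h)).2 hx
    have h1 : ∀ {S}, S ⊆ α.boundaries \ δ.boundaries →
        (comp (α.boundaries \ S)).boundaries = α.boundaries \ S := by
      intro S hS
      rw [boundaries_comp, Finset.insert_eq_of_mem, Finset.insert_eq_of_mem]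
      · exact h0 hS (last_mem_boundaries δ)
      · exact Finset.mem_insert_of_mem (h0 hS (zero_mem_boundaries δ))
    have h2 : α.boundaries \ δ.boundaries = ∅ ↔ δ = α := by
      rw [Finset.sdiff_eq_empty_iff_subset]
      exact ⟨fun h => boundaries_injective (hδ.antisymm h), fun h => h ▸ subset_rfl⟩
    have h3 := Finset.sum_powerset_neg_one_pow_card (x := α.boundaries \ δ.boundaries)
    have h4 : (∑ S ∈ (α.boundaries \ δ.boundaries).powerset, (-1 : ℚ) ^ S.card) =
        if δ = α then 1 else 0 := by
      simp only [h2] at h3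
      exact_mod_cast congrArg (Int.cast : ℤ → ℚ) h3
    rw [← h4]
    refine Finset.sum_nbij' (fun β => α.boundaries \ β.boundaries)
      (fun S => comp (α.boundaries \ S)) ?_ ?_ ?_ ?_ ?_
    · intro β hβ
      obtain ⟨-, -, h⟩ := Finset.mem_filter.1 hβ
      exact Finset.mem_powerset.2 (Finset.sdiff_subset_sdiff subset_rfl h)
    · intro S hS
      rw [Finset.mem_powerset] at hS
      refine Finset.mem_filter.2 ⟨Finset.mem_univ _, ?_, ?_⟩
      · rw [Refines, h1 hS]
        exact Finset.sdiff_subset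
      · rw [Refines, h1 hS]
        exact h0 hS
    · intro β hβ
      obtain ⟨-, h, h'⟩ := Finset.mem_filter.1 hβ
      refine boundaries_injective ?_
      rw [h1 (Finset.sdiff_subset_sdiff subset_rfl h'), Finset.sdiff_sdiff_eq_self h]
    · intro S hS
      rw [Finset.mem_powerset] at hS
      rw [h1 hS, Finset.sdiff_sdiff_eq_self (hS.trans Finset.sdiff_subset)]
    · intro β hβ
      obtain ⟨-, h, -⟩ := Finset.mem_filter.1 hβ
      rw [Finset.card_sdiff_of_subset h, Composition.card_boundaries_eq_succ_length,
        Composition.card_boundaries_eq_succ_length, Nat.add_sub_add_right]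
  · rw [Finset.sum_eq_zero, if_neg]
    · rintro rfl
      exact hδ subset_rfl
    · intro β hβ
      obtain ⟨-, h, h'⟩ := Finset.mem_filter.1 hβ
      exact absurd (h'.trans h) hδ

theorem L_eq_card {n : ℕ} (α β : Composition n) :
    L α β = (Finset.univ.filter fun U : StandardTableau α => U.co = β).card := by
  rw [L, Nat.card_eq_fintype_card, Fintype.card_subtype]

/-- The expansion of the ribbon functions in the immaculate functions. -/
theorem ribbon_eq_sum {n : ℕ} (β : Composition n) :
    ribbon β = ∑ α : Composition n, (L α β : ℚ) • immaculate α := by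
  simp only [ribbon, completeH_eq_sum, Finset.smul_sum]
  rw [Finset.sum_comm]
  refine Finset.sum_congr rfl fun α _ => ?_
  rw [L_eq_card, Finset.card_filter, Nat.cast_sum, Finset.sum_smul]
  simp only [Finset.sum_filter (s := (Finset.univ : Finset (StandardTableau α)))]
  rw [Finset.sum_comm]
  refine Finset.sum_congr rfl fun U _ => ?_
  rw [← Finset.sum_filter, Finset.filter_filter, ← Finset.sum_smul]
  congr 1
  have h := sum_neg_one_pow_length U.co β
  refine (Finset.sum_congr (Finset.filter_congr fun γ _ => ?_) fun _ _ => rfl).trans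
    (h.trans (by push_cast; rfl))
  exact and_congr_right fun _ => (boundaries_comp_subset _ _).symm

/-! ### Unitriangularity of the descent matrix -/

section index
variable {n : ℕ} (β : Composition n)

theorem le_index_iff (i : ℕ) (e : Fin n) :
    i ≤ (β.index e : ℕ) ↔ β.sizeUpTo i ≤ e := by
  constructor
  · exact fun h => (β.monotone_sizeUpTo h).trans (β.sizeUpTo_index_le e)
  · intro h
    by_contra hc
    rw [not_le] at hc
    exact (h.trans_lt (β.lt_sizeUpTo_index_succ e)).not_ge (β.monotone_sizeUpTo hc)

theorem monotone_index : Monotone β.index := fun e e' h => by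
  rw [Fin.le_def, le_index_iff]
  exact (β.sizeUpTo_index_le e).trans h

theorem mem_boundaries_iff_index {d : Fin (n + 1)} (h0 : 0 < (d : ℕ)) (hn : (d : ℕ) < n) :
    d ∈ β.boundaries ↔ β.index ⟨(d : ℕ) - 1, by omega⟩ < β.index ⟨(d : ℕ), hn⟩ := by
  simp only [Composition.boundaries, Finset.mem_map, Finset.mem_univ, true_and]
  constructor
  · rintro ⟨i, hi⟩
    have hd : β.sizeUpTo i = d := congrArg Fin.val hi
    have h1 := (le_index_iff β i ⟨d, hn⟩).2 hd.le
    have h2 := (le_index_iff β i ⟨d - 1, by omega⟩).not.2 (by dsimp only; omega)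
    exact (not_le.1 h2).trans_le h1
  · intro h
    refine ⟨(β.index ⟨d, hn⟩).castSucc, Fin.ext ?_⟩
    have h1 := (le_index_iff β _ _).1 (le_refl (β.index ⟨d, hn⟩ : ℕ))
    have h2 := (le_index_iff β (β.index ⟨d, hn⟩) ⟨d - 1, by omega⟩).not.1 (by simpa using h)
    change β.sizeUpTo (β.index ⟨d, hn⟩) = d
    dsimp only at h1 h2
    omega

theorem sum_index_comp {M : Type*} [AddCommMonoid M] (g : Fin β.length → M) :
    ∑ e, g (β.index e) = ∑ i, β.blocksFun i • g i := by
  rw [← Equiv.sum_comp β.blocksFinEquiv, Fintype.sum_sigma]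
  simp [Composition.blocksFinEquiv]

end index

/-- The statistic `∑_i i α_i`, the rows being numbered from `0`. -/
def rank {n : ℕ} (α : Composition n) : ℕ := ∑ e, (α.index e : ℕ)

/-- The tableau of shape `β` whose rows are filled one after the other has descent
composition `β`. -/
theorem exists_row_eq_index {n : ℕ} (β : Composition n) :
    ∃ U : StandardTableau β, U.row = β.index ∧ U.co = β := by
  obtain ⟨U, hU⟩ := StandardTableau.exists_row_eq β.index (fun i => by
    rw [Finset.card_filter, sum_index_comp β fun j => if j = i then 1 else 0]
    simp) (fun k i hi => by
      refine ⟨β.embedding i ⟨0, β.one_le_blocksFun i⟩, ?_, β.index_embedding _ _⟩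
      by_contra hc
      have := monotone_index β (not_lt.1 hc)
      rw [β.index_embedding] at this
      exact this.not_gt hi)
  refine ⟨U, hU, boundaries_injective ?_⟩
  rw [StandardTableau.co, boundaries_comp]
  ext d
  rw [Finset.mem_insert, Finset.mem_insert, U.mem_descents, hU]
  by_cases h0 : d = 0
  · simp [h0, zero_mem_boundaries]
  by_cases hn : d = Fin.last n
  · simp [hn, last_mem_boundaries]
  have h0' : 0 < (d : ℕ) := Nat.pos_of_ne_zero fun h => h0 (Fin.ext h)
  have hn' : (d : ℕ) < n := Fin.val_lt_last hn
  simp [h0, hn, h0', hn', mem_boundaries_iff_index β h0' hn']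

namespace StandardTableau

variable {n : ℕ} {α : Composition n}

/-- The labels of the `i`-th run of a tableau lie in the first `i` rows, since only the first
letter of a run can start a new row. -/
theorem row_le_index (U : StandardTableau α) (e : Fin n) :
    (U.row e : ℕ) ≤ U.co.index e := by
  obtain ⟨e, he⟩ := e
  induction e using Nat.strong_induction_on with
  | _ e ih =>
    rcases Nat.eq_zero_or_pos (U.row ⟨e, he⟩ : ℕ) with h | h
    · omega
    obtain ⟨k, hk, hkr⟩ := U.exists_lt_row_eq ⟨e, he⟩ ⟨(U.row ⟨e, he⟩ : ℕ) - 1, by omega⟩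
      (Fin.lt_def.2 (by dsimp only; omega))
    have hk' : (k : ℕ) < e := hk
    -- If `e` starts a run, all smaller labels belong to earlier runs.
    by_cases hd : U.row ⟨e - 1, by omega⟩ < U.row ⟨e, he⟩
    · have hmem : (⟨e, by omega⟩ : Fin (n + 1)) ∈ U.co.boundaries := by
        rw [co, boundaries_comp]
        exact Finset.mem_insert_of_mem (Finset.mem_insert_of_mem
          ((U.mem_descents _).2 ⟨by dsimp only; omega, he, hd⟩))
      have h1 := (mem_boundaries_iff_index U.co (by dsimp only; omega) he).1 hmem
      have h2 := ih k hk' k.2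
      have h3 : U.co.index k ≤ U.co.index ⟨e - 1, by omega⟩ :=
        monotone_index _ (Fin.le_def.2 (by dsimp only; omega))
      simp only [Fin.eta, hkr] at h2
      simp only [Fin.le_def, Fin.lt_def] at h1 h3
      omega
    · have h2 := ih (e - 1) (by omega) (by omega)
      have h3 : U.co.index ⟨e - 1, by omega⟩ ≤ U.co.index ⟨e, he⟩ :=
        monotone_index _ (Fin.le_def.2 (by dsimp only; omega))
      simp only [Fin.le_def, Fin.lt_def] at hd h3
      omega

theorem sum_row (U : StandardTableau α) : ∑ e, (U.row e : ℕ) = rank α := by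
  rw [rank, sum_index_comp α fun i => (i : ℕ), ← Equiv.sum_comp U.label, Fintype.sum_sigma]
  simp [row_label]

theorem rank_le (U : StandardTableau α) : rank α ≤ rank U.co := by
  rw [← U.sum_row]
  exact Finset.sum_le_sum fun e _ => U.row_le_index e

/-- A tableau for which the rank inequality is an equality is the one filled row by row. -/
theorem sigma_eq_of_rank_eq (U : StandardTableau α) {β : Composition n} (hβ : U.co = β)
    (h : rank α = rank β) {V : StandardTableau β} (hV : V.row = β.index) :
    (⟨α, U⟩ : (α : Composition n) × StandardTableau α) = ⟨β, V⟩ := by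
  subst hβ
  refine word_injective ?_
  rw [← U.sum_row, rank] at h
  have := (Finset.sum_eq_sum_iff_of_le fun e _ => U.row_le_index e).1 h
  dsimp only
  rw [word, word, hV]
  congr 2
  funext e
  exact this e (Finset.mem_univ e)

end StandardTableau

theorem rank_lt_of_adj {n : ℕ} {α β : Composition n} (h : (descentGraph n).Adj α β) :
    rank α < rank β := by
  obtain ⟨hne, U, rfl⟩ := h
  refine U.rank_le.lt_of_ne fun he => hne ?_
  obtain ⟨V, hV, -⟩ := exists_row_eq_index U.co
  exact congrArg Sigma.fst (U.sigma_eq_of_rank_eq rfl he hV)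

theorem L_self {n : ℕ} (β : Composition n) : L β β = 1 := by
  obtain ⟨V, hV, hco⟩ := exists_row_eq_index β
  rw [L_eq_card, Finset.card_eq_one]
  refine ⟨V, Finset.eq_singleton_iff_unique_mem.2 ⟨by simpa using hco, fun U hU => ?_⟩⟩
  exact eq_of_heq (Sigma.mk.inj (U.sigma_eq_of_rank_eq (by simpa using hU) rfl hV)).2

theorem L_eq_zero {n : ℕ} {α β : Composition n} (hne : α ≠ β)
    (h : ¬ (descentGraph n).Adj α β) : L α β = 0 := by
  rw [L_eq_card, Finset.card_eq_zero, Finset.filter_eq_empty_iff]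
  exact fun U _ hU => h ⟨hne, U, hU⟩

/-! ### Path sums in a graded digraph -/

section paths

variable {V : Type*} {G : Digraph V}

theorem DiPath.vertices_injective {u v : V} :
    Function.Injective (DiPath.vertices : DiPath G u v → List V) :=
  fun _ _ h => Subtype.ext (Subtype.ext h)

variable [Fintype V]

/-- The vertex lists of the paths from `u` to `v`. -/
noncomputable def pathLists (G : Digraph V) (u v : V) : Finset (List V) :=
  (Finset.univ : Finset (DiPath G u v)).image DiPath.vertices

variable {rk : V → ℕ}

/-- Along a graph with a strictly increasing rank, the vertices of a walk are distinct. -/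
theorem mem_pathLists (hG : ∀ a b, G.Adj a b → rk a < rk b) {u v : V} {l : List V} :
    l ∈ pathLists G u v ↔ l.IsChain G.Adj ∧ l.head? = some u ∧ l.getLast? = some v := by
  rw [pathLists, Finset.mem_image]
  constructor
  · rintro ⟨P, -, rfl⟩
    exact P.2
  · intro h
    have h1 : l.IsChain fun a b => rk a < rk b := h.1.imp hG
    have : Trans (fun a b => rk a < rk b) (fun a b : V => rk a < rk b)
      (fun a b => rk a < rk b) := ⟨fun h h' => lt_trans h h'⟩
    have h2 : l.Nodup := (List.isChain_iff_pairwise.1 h1).imp fun h => by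
      rintro rfl; exact h.false
    exact ⟨⟨⟨l, h2⟩, h⟩, Finset.mem_univ _, rfl⟩

/-- The signed and weighted sum over the paths from `u` to `v`. -/
noncomputable def pathSum (G : Digraph V) (wt : V → V → ℕ) (u v : V) : ℤ :=
  ∑ P : DiPath G u v, (-1 : ℤ) ^ P.length * (P.prod wt : ℤ)

theorem pathSum_eq (wt : V → V → ℕ) (u v : V) :
    pathSum G wt u v = ∑ l ∈ pathLists G u v,
      (-1 : ℤ) ^ l.tail.length * ((List.zipWith wt l l.tail).prod : ℤ) := by
  rw [pathLists, Finset.sum_image fun P _ Q _ h => DiPath.vertices_injective h]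
  rfl

/-- The decomposition of a path sum by the first edge. -/
theorem pathSum_eq_sub_sum (hG : ∀ a b, G.Adj a b → rk a < rk b) (wt : V → V → ℕ) (u v : V) :
    pathSum G wt u v = (if u = v then 1 else 0) -
      ∑ c with G.Adj u c, (wt u c : ℤ) * pathSum G wt c v := by
  have hset : pathLists G u v = (if u = v then {[u]} else ∅) ∪
      (Finset.univ.filter fun c => G.Adj u c).biUnion fun c =>
        (pathLists G c v).image (u :: ·) := by
    ext l
    simp only [Finset.mem_union, Finset.mem_biUnion, Finset.mem_filter, Finset.mem_univ, true_and,
      Finset.mem_image, mem_pathLists hG]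
    constructor
    · rintro ⟨h1, h2, h3⟩
      match l, h1, h2, h3 with
      | [a], _, h2, h3 =>
        obtain rfl : a = u := by simpa using h2
        obtain rfl : a = v := by simpa using h3
        simp
      | a :: c :: l, h1, h2, h3 =>
        obtain rfl : a = u := by simpa using h2
        rw [List.isChain_cons_cons] at h1
        exact Or.inr ⟨c, h1.1, c :: l, ⟨h1.2, rfl, by simpa using h3⟩, rfl⟩
    · rintro (h | ⟨c, hc, l, ⟨h1, h2, h3⟩, rfl⟩)
      · split_ifs at h with huv
        · subst huv
          obtain rfl : l = [u] := by simpa using h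
          simp
        · simp at h
      · match l, h1, h2, h3 with
        | a :: l, h1, h2, h3 =>
          obtain rfl : a = c := by simpa using h2
          exact ⟨List.isChain_cons_cons.2 ⟨hc, h1⟩, rfl, by simpa using h3⟩
  have hhead {c : V} {l : List V} (h : l ∈ pathLists G c v) : l.head? = some c :=
    ((mem_pathLists hG).1 h).2.1
  rw [pathSum_eq, hset, Finset.sum_union, Finset.sum_biUnion, sub_eq_add_neg,
    ← Finset.sum_neg_distrib]
  · congr 1
    · split_ifs <;> simp
    · refine Finset.sum_congr rfl fun c _ => ?_
      rw [Finset.sum_image (by simp), pathSum_eq, Finset.mul_sum, ← Finset.sum_neg_distrib]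
      refine Finset.sum_congr rfl fun l hl => ?_
      match l, hhead hl with
      | a :: l, h =>
        obtain rfl : a = c := by simpa using h
        simp only [List.tail_cons, List.length_cons, List.zipWith_cons_cons, List.prod_cons]
        push_cast
        ring
  · intro c _ c' _ hne
    rw [Function.onFun, Finset.disjoint_left]
    rintro l hl hl'
    obtain ⟨p, hp, rfl⟩ := Finset.mem_image.1 hl
    obtain ⟨p', hp', h⟩ := Finset.mem_image.1 hl'
    obtain rfl : p' = p := (List.cons.inj h).2
    exact hne (Option.some.inj ((hhead hp).symm.trans (hhead hp')))
  · rw [Finset.disjoint_left]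
    intro l hl hl'
    obtain ⟨c, -, hl'⟩ := Finset.mem_biUnion.1 hl'
    obtain ⟨p, hp, rfl⟩ := Finset.mem_image.1 hl'
    split_ifs at hl
    · obtain rfl : p = [] := by simpa using hl
      simpa using hhead hp
    · simp at hl

/-- For unitriangular weights, the path sums form the inverse matrix of the weights. -/
theorem sum_mul_pathSum (hG : ∀ a b, G.Adj a b → rk a < rk b) (wt : V → V → ℕ)
    (hwt : ∀ a, wt a a = 1) (hwt' : ∀ a b, a ≠ b → ¬ G.Adj a b → wt a b = 0) (u v : V) :
    ∑ c, (wt u c : ℤ) * pathSum G wt c v = if u = v then 1 else 0 := by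
  have hu : ¬ G.Adj u u := fun h => (hG u u h).false
  have h1 : ∑ c ∈ Finset.univ.erase u, (wt u c : ℤ) * pathSum G wt c v =
      ∑ c with G.Adj u c, (wt u c : ℤ) * pathSum G wt c v := by
    symm
    refine Finset.sum_subset ?_ ?_
    · intro c hc
      refine Finset.mem_erase.2 ⟨?_, Finset.mem_univ _⟩
      rintro rfl
      exact hu (Finset.mem_filter.1 hc).2
    · intro c hc hc'
      rw [hwt' u c (Finset.ne_of_mem_erase hc).symm (by simpa using hc'), Nat.cast_zero, zero_mul]
  rw [← Finset.add_sum_erase _ _ (Finset.mem_univ u), h1, hwt, Nat.cast_one, one_mul,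
    pathSum_eq_sub_sum hG, sub_add_cancel]

end paths

end Immaculate

theorem mainTheorem9 (n : ℕ) (β : Composition n) :
    Immaculate.immaculate β =
      ∑ α : Composition n, (Immaculate.Linv α β : ℚ) • Immaculate.ribbon α := by
  have key (γ : Composition n) :
      ∑ α, (Immaculate.Linv α β : ℚ) * (Immaculate.L γ α : ℚ) = if γ = β then 1 else 0 := by
    have h := Immaculate.sum_mul_pathSum (G := Immaculate.descentGraph n)
      (fun _ _ => Immaculate.rank_lt_of_adj) Immaculate.L Immaculate.L_self
      (fun _ _ => Immaculate.L_eq_zero) γ β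
    have h' := congrArg (Int.cast : ℤ → ℚ) h
    push_cast at h'
    rw [← h']
    exact Finset.sum_congr rfl fun α _ => mul_comm _ _
  simp only [Immaculate.ribbon_eq_sum, Finset.smul_sum, smul_smul]
  rw [Finset.sum_comm]
  simp only [← Finset.sum_smul, key, ite_smul, one_smul, zero_smul, Finset.sum_ite_eq',
    Finset.mem_univ, if_true]
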